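/- An edge periodic graph (EPG) $\mathcal{G}=(V,E,\tau)$ consists of a finite simple undirected graph $G=(V,E)$ and a map $\tau:E\to\{0,1\}^*$ such that every word $\tau(e)$ contains at least one $1$. For a time step $t\in\{0,1,2,\dots\}$, the snapshot $\mathcal{G}(t)$ is the graph with vertex set $V$ whose edges are those $e\in E$ for which the letter of $\tau(e)$ at position $t \bmod |\tau(e)|$ (positions counted from $0$) is $1$. Let $\#1_{\max}$ and $\#0_{\max}$ denote the maximal number of ones and of zeros, respectively, in a word $\tau(e)$, over all $e\in E$ (both are $0$ if $E=\emptyset$). A graph $H$ is a minor of a graph $F$ if a graph isomorphic to $H$ can be obtained from $F$ by deleting vertices, deleting edges and contracting edges. Consider the following four decision problems, whose input is an EPG $\mathcal{G}=(V,E,\tau)$, with its edge labels written out as words, and a finite simple graph $H$: - EPG-Subgraph: is there a time step $t$ such that $\mathcal{G}(t)$ contains an induced subgraph isomorphic to $H$? - EPG-Subgraph-Free: is there a time step $t$ such that $\mathcal{G}(t)$ contains no induced subgraph isomorphic to $H$? - EPG-Minor: is there a time step $t$ such that $H$ is a minor of $\mathcal{G}(t)$? - EPG-Minor-Free: is there a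 time step $t$ such that $H$ is not a minor of $\mathcal{G}(t)$? Theorem. Each of these four problems is fixed-parameter tractable with respect to the combined parameter $k=|V|+\min(\#1_{\max},\#0_{\max})$; that is, for each of them there are a deterministic algorithm (a random access machine with unit-cost addition, subtraction and halving, a model polynomially equivalent to Turing machines), a computable function $f:\mathbb{N}\to\mathbb{N}$ and a polynomial $p$ such that the algorithm decides every instance correctly in at most $f(k)\cdot p(N)$ steps, where $N$ is the length of the encoding of the instance. -/

import Mathlib

/-! ### Machine model

Programs for a random access machine with finitely many named registers and an unbounded indirectly
addressed memory, both holding natural numbers. The arithmetic operations are addition, truncated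
subtraction and halving, each at unit cost; there is deliberately no multiplication. In `T` steps
numbers can gain only `O(T)` bits, so the model is polynomially equivalent to Turing machines. -/

namespace RAM

/-- A machine state: registers and memory. -/
structure State where
  reg : ℕ → ℕ
  mem : ℕ → ℕ

/-- Arithmetic expressions. -/
inductive Expr where
  | const (k : ℕ)
  | reg (i : ℕ)
  | read (address : Expr)
  | add (a b : Expr)
  | sub (a b : Expr)
  | half (a : Expr)

/-- The value of an expression in a state. -/
def Expr.eval (s : State) : Expr → ℕ
  | .const k => k
  | .reg i => s.reg i
  | .read a => s.mem (a.eval s)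
  | .add a b => a.eval s + b.eval s
  | .sub a b => a.eval s - b.eval s
  | .half a => a.eval s / 2

/-- The number of elementary operations needed to evaluate an expression. -/
def Expr.cost : Expr → ℕ
  | .const _ => 1
  | .reg _ => 1
  | .read a => a.cost + 1
  | .add a b => a.cost + b.cost + 1
  | .sub a b => a.cost + b.cost + 1
  | .half a => a.cost + 1

/-- Programs. A guard counts as true when its value is nonzero. -/
inductive Program where
  | skip
  | assign (i : ℕ) (e : Expr)
  | write (address e : Expr)
  | seq (p q : Program)
  | branch (guard : Expr) (p q : Program)
  | loop (guard : Expr) (body : Program)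

/-- `Run p s s' T`: started in state `s`, the program `p` halts in state `s'` after exactly
`T` steps. -/
inductive Run : Program → State → State → ℕ → Prop where
  | skip (s : State) : Run .skip s s 1
  | assign (s : State) (i : ℕ) (e : Expr) :
      Run (.assign i e) s ⟨Function.update s.reg i (e.eval s), s.mem⟩ (e.cost + 1)
  | write (s : State) (a e : Expr) :
      Run (.write a e) s ⟨s.reg, Function.update s.mem (a.eval s) (e.eval s)⟩
        (a.cost + e.cost + 1)
  | seq {p q : Program} {s s' s'' : State} {T T' : ℕ} :
      Run p s s' T → Run q s' s'' T' → Run (.seq p q) s s'' (T + T')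
  | branch_true {g : Expr} {p q : Program} {s s' : State} {T : ℕ} :
      g.eval s ≠ 0 → Run p s s' T → Run (.branch g p q) s s' (g.cost + 1 + T)
  | branch_false {g : Expr} {p q : Program} {s s' : State} {T : ℕ} :
      g.eval s = 0 → Run q s s' T → Run (.branch g p q) s s' (g.cost + 1 + T)
  | loop_done {g : Expr} {p : Program} {s : State} :
      g.eval s = 0 → Run (.loop g p) s s (g.cost + 1)
  | loop_step {g : Expr} {p : Program} {s s' s'' : State} {T T' : ℕ} :
      g.eval s ≠ 0 → Run p s s' T → Run (.loop g p) s' s'' T' →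
        Run (.loop g p) s s'' (g.cost + 1 + T + T')

/-- The machine is deterministic: final state and number of steps are determined by program and
initial state. -/
theorem Run.deterministic {p : Program} {s s₁ s₂ : State} {T₁ T₂ : ℕ}
    (h₁ : Run p s s₁ T₁) (h₂ : Run p s s₂ T₂) : s₁ = s₂ ∧ T₁ = T₂ := by
  induction h₁ generalizing s₂ T₂ with
  | skip => cases h₂; exact ⟨rfl, rfl⟩
  | assign => cases h₂; exact ⟨rfl, rfl⟩
  | write => cases h₂; exact ⟨rfl, rfl⟩
  | seq _ _ ih ih' =>
    cases h₂ with
    | seq k k' =>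
      obtain ⟨rfl, rfl⟩ := ih k
      obtain ⟨rfl, rfl⟩ := ih' k'
      exact ⟨rfl, rfl⟩
  | branch_true h _ ih =>
    cases h₂ with
    | branch_true _ k => obtain ⟨rfl, rfl⟩ := ih k; exact ⟨rfl, rfl⟩
    | branch_false h' _ => exact absurd h' h
  | branch_false h _ ih =>
    cases h₂ with
    | branch_true h' _ => exact absurd h h'
    | branch_false _ k => obtain ⟨rfl, rfl⟩ := ih k; exact ⟨rfl, rfl⟩
  | loop_done h =>
    cases h₂ with
    | loop_done => exact ⟨rfl, rfl⟩
    | loop_step h' _ _ => exact absurd h h'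
  | loop_step h _ _ ih ih' =>
    cases h₂ with
    | loop_done h' => exact absurd h' h
    | loop_step _ k k' =>
      obtain ⟨rfl, rfl⟩ := ih k
      obtain ⟨rfl, rfl⟩ := ih' k'
      exact ⟨rfl, rfl⟩

/-- The initial state on input word `w`: register `0` holds the length of `w`, memory cell `i` holds
the `i`-th letter of `w`, and everything else is `0`. -/
def State.init (w : List (Fin 3)) : State where
  reg i := if i = 0 then w.length else 0
  mem i := (w[i]?.map Fin.val).getD 0

end RAM

/-! ### Fixed-parameter tractability -/

/-- A parameterized decision problem: instances, their encoding as words over a three-letter alphabet,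
the parameter, and the yes-instances. -/
structure ParamProblem where
  Instance : Type
  encode : Instance → List (Fin 3)
  param : Instance → ℕ
  Yes : Instance → Prop

/-- A parameterized problem is fixed-parameter tractable if a single program decides every instance
(answering `1` or `0` in register `0`) in at most `f(k) · p(N)` steps, where `k` is the parameter,
`N` the length of the encoding, `f` a computable function and `p` a polynomial. -/
def ParamProblem.IsFPT (P : ParamProblem) : Prop :=
  ∃ (A : RAM.Program) (f : ℕ → ℕ) (p : Polynomial ℕ), Computable f ∧
    ∀ x : P.Instance, ∃ (s : RAM.State) (T : ℕ),
      RAM.Run A (RAM.State.init (P.encode x)) s T ∧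
      T ≤ f (P.param x) * p.eval (P.encode x).length ∧
      (P.Yes x → s.reg 0 = 1) ∧ (¬ P.Yes x → s.reg 0 = 0)

/-! ### Minors -/

/-- Contraction of the edge `uv`: the vertex `v` is removed and `u` takes over its neighbours. -/
def SimpleGraph.contractEdge {V : Type} (G : SimpleGraph V) (u v : V) :
    SimpleGraph {x : V // x ≠ v} where
  Adj x y := x ≠ y ∧
    (G.Adj x y ∨ ((x : V) = u ∧ G.Adj v y) ∨ ((y : V) = u ∧ G.Adj v x))
  symm := ⟨by
    rintro x y ⟨hne, h⟩
    refine ⟨hne.symm, ?_⟩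
    rcases h with h | h | h
    · exact Or.inl h.symm
    · exact Or.inr (Or.inr h)
    · exact Or.inr (Or.inl h)⟩
  loopless := ⟨fun _ h => h.1 rfl⟩

/-- `H.IsMinorOf G`: a graph isomorphic to `H` arises from `G` by a finite sequence of vertex
deletions, edge deletions and edge contractions. -/
inductive SimpleGraph.IsMinorOf {W : Type} (H : SimpleGraph W) :
    {V : Type} → SimpleGraph V → Prop where
  | iso {V : Type} {G : SimpleGraph V} : Nonempty (H ≃g G) → H.IsMinorOf G
  | deleteVertex {V : Type} {G : SimpleGraph V} (v : V) :
      H.IsMinorOf (G.induce {x | x ≠ v}) → H.IsMinorOf G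
  | deleteEdge {V : Type} {G : SimpleGraph V} (e : Sym2 V) :
      e ∈ G.edgeSet → H.IsMinorOf (G.deleteEdges {e}) → H.IsMinorOf G
  | contract {V : Type} {G : SimpleGraph V} (u v : V) :
      G.Adj u v → H.IsMinorOf (G.contractEdge u v) → H.IsMinorOf G

/-! ### Edge periodic graphs -/

/-- The letter at position `t` of the periodic repetition of `w` (irrelevant default for empty `w`). -/
def periodicLetter (w : List Bool) (t : ℕ) : Bool :=
  w.getD (t % w.length) false

/-- An edge periodic graph on `V`: an underlying graph whose edges are labelled by binary words, each
containing at least one `1`. -/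
structure EPG (V : Type) where
  graph : SimpleGraph V
  label : graph.edgeSet → List Bool
  one_mem : ∀ e, true ∈ label e

namespace EPG

variable {V : Type}

/-- The snapshot `𝒢(t)`: all vertices, and the edges present at time `t`. -/
def snapshot (𝒢 : EPG V) (t : ℕ) : SimpleGraph V where
  Adj u v := ∃ h : s(u, v) ∈ 𝒢.graph.edgeSet, periodicLetter (𝒢.label ⟨s(u, v), h⟩) t = true
  symm := ⟨fun u v h => by rw [Sym2.eq_swap]; exact h⟩
  loopless := ⟨fun _ ⟨h, _⟩ => 𝒢.graph.loopless.irrefl _ h⟩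

/-- The maximal number of ones in an edge label (`0` if there is no edge), for finite `V`. -/
noncomputable def maxOnes (𝒢 : EPG V) : ℕ := ⨆ e, (𝒢.label e).count true

/-- The maximal number of zeros in an edge label (`0` if there is no edge), for finite `V`. -/
noncomputable def maxZeros (𝒢 : EPG V) : ℕ := ⨆ e, (𝒢.label e).count false

open Classical in
/-- The label of the edge `uv` as a word over `{0, 1}`; the empty word if `uv` is not an edge. -/
noncomputable def labelWord (𝒢 : EPG V) (u v : V) : List (Fin 3) :=
  if h : s(u, v) ∈ 𝒢.graph.edgeSet then
    (𝒢.label ⟨s(u, v), h⟩).map fun b => if b then 1 else 0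
  else []

/-- Encoding of an edge periodic graph on `n` vertices: `1ⁿ2`, followed by the `n × n` matrix of label
words, row by row, each word terminated by the letter `2`. -/
noncomputable def encode {n : ℕ} (𝒢 : EPG (Fin n)) : List (Fin 3) :=
  List.replicate n 1 ++ [2] ++
    (List.finRange n).flatMap fun u => (List.finRange n).flatMap fun v => 𝒢.labelWord u v ++ [2]

end EPG

open Classical in
/-- Encoding of a graph on `m` vertices: `1ᵐ2`, followed by the adjacency matrix, row by row. -/
noncomputable def SimpleGraph.encode {m : ℕ} (H : SimpleGraph (Fin m)) : List (Fin 3) :=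
  List.replicate m 1 ++ [2] ++
    (List.finRange m).flatMap fun u => (List.finRange m).map fun v => if H.Adj u v then 1 else 0

/-- An instance of each of the four problems: an edge periodic graph `𝒢` and a graph `H`. -/
structure EPGInstance where
  n : ℕ
  𝒢 : EPG (Fin n)
  m : ℕ
  H : SimpleGraph (Fin m)

namespace EPGInstance

/-- The encoding of an instance. -/
noncomputable def encode (x : EPGInstance) : List (Fin 3) := x.𝒢.encode ++ x.H.encode

/-- The parameter `|V| + min(#1_max, #0_max)`. -/
noncomputable def param (x : EPGInstance) : ℕ := x.n + min x.𝒢.maxOnes x.𝒢.maxZeros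

end EPGInstance

/-- Is `H` an induced subgraph of some snapshot? -/
noncomputable def EPGSubgraph : ParamProblem where
  Instance := EPGInstance
  encode := EPGInstance.encode
  param := EPGInstance.param
  Yes x := ∃ t : ℕ, x.H.IsIndContained (x.𝒢.snapshot t)

/-- Is there a snapshot that does not contain `H` as an induced subgraph? -/
noncomputable def EPGSubgraphFree : ParamProblem where
  Instance := EPGInstance
  encode := EPGInstance.encode
  param := EPGInstance.param
  Yes x := ∃ t : ℕ, ¬ x.H.IsIndContained (x.𝒢.snapshot t)

/-- Is `H` a minor of some snapshot? -/
noncomputable def EPGMinor : ParamProblem where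
  Instance := EPGInstance
  encode := EPGInstance.encode
  param := EPGInstance.param
  Yes x := ∃ t : ℕ, x.H.IsMinorOf (x.𝒢.snapshot t)

/-- Is there a snapshot that does not contain `H` as a minor? -/
noncomputable def EPGMinorFree : ParamProblem where
  Instance := EPGInstance
  encode := EPGInstance.encode
  param := EPGInstance.param
  Yes x := ∃ t : ℕ, ¬ x.H.IsMinorOf (x.𝒢.snapshot t)

/-! ### Functions computable in fixed-parameter time

The programs constructed here never write to memory. -/

/-! Let `N` be the length of the encoding. Fix the letter, `0` or `1`, whose maximal number of
occurrences per label is smaller, and let `μ` be that number. A snapshot is determined by the labels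
that show this letter at time `t`, hence by the congruences `t ≡ p mod L` that `t` satisfies, where
`L` is the length of a label and `p` the position of an occurrence of the letter. There are at most
`K = n² (μ + 1)` of them, which is bounded in terms of the parameter.

Guess the set of satisfied congruences (`2 ^ K` cases). If some `t` satisfies exactly these, its
class is a progression `r + j M`, with `M` the least common multiple of the selected moduli
(`residue_spec`). The remaining congruences must fail. By `exists_lt_two_pow_avoiding`, if `K`
residue classes miss some term of a progression, they miss one of its first `2 ^ K` terms: up to
nonzero constants, membership of the `j`-th term in some class is the vanishing of a product of `K`
binomials in powers of roots of unity, which is an exponential sum in `j` with `2 ^ K` terms and so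
obeys a linear recurrence of order `2 ^ K`. Hence the `4 ^ K` times `timeAt c j` already exhibit
every snapshot (`exists_snapshot_timeAt`).

At a given time, `H` is tested by brute force over `n × n` bit matrices, which encode an embedding
or the branch sets of a minor model (`inducedAt_iff`, `minorAt_iff`); the `-Free` problems negate
this test.

It remains to run this on a machine without multiplication. Candidate times can be exponentially
large, but have fewer than `(N + 1) (K + 1)` bits, so remainders are found by binary long division.
`Comp Γ f` packages a program for `f` with a time bound of the form `f(k) · p(N)`; closure under
bounded recursion (`Comp.fold`) yields all other operations. -/

namespace RAM

variable {I : Type} {enc : I → List (Fin 3)} {par : I → ℕ} {α : Type} {ι : α → I}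

/-- The memory content at address `i` on input `w`. -/
def letterAt (w : List (Fin 3)) (i : ℕ) : ℕ := (w[i]?.map Fin.val).getD 0

/-- A context describes what is known about the state when a subprogram is started: `ok a s` says
that the registers of `s` below `depth` hold the data described by `a`. -/
structure Ctx (enc : I → List (Fin 3)) (par : I → ℕ) {α : Type} (ι : α → I) where
  depth : ℕ
  ok : α → State → Prop
  frame : ∀ {a s s'}, ok a s → (∀ i < depth, s'.reg i = s.reg i) → s'.mem = s.mem → ok a s'
  depth_pos : 0 < depth
  reg_zero : ∀ {a s}, ok a s → s.reg 0 = (enc (ι a)).length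
  mem_eq : ∀ {a s}, ok a s → s.mem = letterAt (enc (ι a))

/-- The data that occur in a context. -/
def Ctx.dom (Γ : Ctx enc par ι) (a : α) : Prop := ∃ s, Γ.ok a s

/-- `c` is bounded by a computable function of the parameter times a polynomial in the length. -/
def Ctx.Bdd (Γ : Ctx enc par ι) (c : α → ℕ) : Prop :=
  ∃ (f : ℕ → ℕ) (p : Polynomial ℕ), Computable f ∧
    ∀ a, Γ.dom a → c a ≤ f (par (ι a)) * p.eval (enc (ι a)).length

/-- `c` is bounded by a computable function of the parameter. -/
def Ctx.ParBdd (Γ : Ctx enc par ι) (c : α → ℕ) : Prop :=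
  ∃ f : ℕ → ℕ, Computable f ∧ ∀ a, Γ.dom a → c a ≤ f (par (ι a))

/-- Some program computes `f`: for every register `D` beyond the context there is a program that
puts `f a` into `D` and changes neither the registers below `D` nor the memory. -/
def Comp (Γ : Ctx enc par ι) (f : α → ℕ) : Prop :=
  ∀ D, Γ.depth ≤ D → ∃ (p : Program) (c : α → ℕ), Γ.Bdd c ∧
    ∀ a s, Γ.ok a s → ∃ s' T, Run p s s' T ∧ T ≤ c a ∧ s'.reg D = f a ∧
      (∀ i < D, s'.reg i = s.reg i) ∧ s'.mem = s.mem

/-- Some program decides the predicate `P`. -/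
def CompP (Γ : Ctx enc par ι) (P : α → Prop) : Prop :=
  ∃ f, Comp Γ f ∧ ∀ a, Γ.dom a → (f a ≠ 0 ↔ P a)

/-- `Γ'` is the context `Γ` with one more number. -/
structure Ext (Γ' : Ctx enc par (fun x : α × ℕ => ι x.1)) (Γ : Ctx enc par ι) : Prop where
  depth_le : Γ.depth ≤ Γ'.depth
  ok : ∀ {x s}, Γ'.ok x s → Γ.ok x.1 s

/-- `S` holds in every context that arises from `Γ` by adding a number less than `b`. -/
def Under (Γ : Ctx enc par ι) (b : α → ℕ)
    (S : Ctx enc par (fun x : α × ℕ => ι x.1) → Prop) : Prop :=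
  ∀ Γ' : Ctx enc par (fun x : α × ℕ => ι x.1), Ext Γ' Γ → (∀ x, Γ'.dom x → x.2 < b x.1) →
    Comp Γ' Prod.snd → S Γ'

variable {Γ : Ctx enc par ι} {Γ' : Ctx enc par (fun x : α × ℕ => ι x.1)}
  {f g h b c c' : α → ℕ} {P Q : α → Prop}

theorem Ext.dom (E : Ext Γ' Γ) {x : α × ℕ} (hx : Γ'.dom x) : Γ.dom x.1 :=
  let ⟨s, hs⟩ := hx; ⟨s, E.ok hs⟩

/-! ### Calculus of time bounds. -/

namespace Ctx

theorem computable_add {f g : ℕ → ℕ} (hf : Computable f) (hg : Computable g) :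
    Computable fun k => f k + g k := Primrec.nat_add.to_comp.comp hf hg

theorem computable_mul {f g : ℕ → ℕ} (hf : Computable f) (hg : Computable g) :
    Computable fun k => f k * g k := Primrec.nat_mul.to_comp.comp hf hg

theorem computable_two_pow {f : ℕ → ℕ} (hf : Computable f) : Computable fun k => 2 ^ f k := by
  have h : Primrec fun n : ℕ => 2 ^ n := by
    have := Primrec.nat_rec₁ 1 (f := fun _ y => 2 * y)
      ((Primrec.nat_mul.comp (Primrec.const 2) Primrec.snd).to₂)
    refine this.of_eq fun n => ?_
    induction n with
    | zero => rfl
    | succ n ih => simp only [pow_succ'] at ih ⊢; rw [← ih]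
  exact h.to_comp.comp hf

theorem ParBdd.bdd (h : Γ.ParBdd c) : Γ.Bdd c := by
  obtain ⟨f, hf, h⟩ := h
  exact ⟨f, 1, hf, fun a ha => by simpa using h a ha⟩

theorem ParBdd.mono (h : Γ.ParBdd c) (hc : ∀ a, Γ.dom a → c' a ≤ c a) : Γ.ParBdd c' := by
  obtain ⟨f, hf, h⟩ := h
  exact ⟨f, hf, fun a ha => (hc a ha).trans (h a ha)⟩

theorem ParBdd.const (k : ℕ) : Γ.ParBdd fun _ => k :=
  ⟨fun _ => k, Computable.const k, fun _ _ => le_rfl⟩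

theorem ParBdd.add (h : Γ.ParBdd c) (h' : Γ.ParBdd c') : Γ.ParBdd fun a => c a + c' a := by
  obtain ⟨f, hf, h⟩ := h
  obtain ⟨f', hf', h'⟩ := h'
  exact ⟨_, computable_add hf hf', fun a ha => Nat.add_le_add (h a ha) (h' a ha)⟩

theorem ParBdd.mul (h : Γ.ParBdd c) (h' : Γ.ParBdd c') : Γ.ParBdd fun a => c a * c' a := by
  obtain ⟨f, hf, h⟩ := h
  obtain ⟨f', hf', h'⟩ := h'
  exact ⟨_, computable_mul hf hf', fun a ha => Nat.mul_le_mul (h a ha) (h' a ha)⟩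

theorem ParBdd.two_pow (h : Γ.ParBdd c) : Γ.ParBdd fun a => 2 ^ c a := by
  obtain ⟨f, hf, h⟩ := h
  exact ⟨_, computable_two_pow hf, fun a ha => Nat.pow_le_pow_right (by norm_num) (h a ha)⟩

theorem ParBdd.param : Γ.ParBdd fun a => par (ι a) := ⟨_, Computable.id, fun _ _ => le_rfl⟩

theorem Bdd.mono (h : Γ.Bdd c) (hc : ∀ a, Γ.dom a → c' a ≤ c a) : Γ.Bdd c' := by
  obtain ⟨f, p, hf, h⟩ := h
  exact ⟨f, p, hf, fun a ha => (hc a ha).trans (h a ha)⟩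

theorem Bdd.const (k : ℕ) : Γ.Bdd fun _ => k := (ParBdd.const k).bdd

theorem Bdd.add (h : Γ.Bdd c) (h' : Γ.Bdd c') : Γ.Bdd fun a => c a + c' a := by
  obtain ⟨f, p, hf, h⟩ := h
  obtain ⟨f', p', hf', h'⟩ := h'
  refine ⟨_, p + p', computable_add hf hf', fun a ha => ?_⟩
  have h1 := h a ha
  have h2 := h' a ha
  simp only [Polynomial.eval_add]
  nlinarith [Nat.zero_le (f (par (ι a)) * p'.eval (enc (ι a)).length),
    Nat.zero_le (f' (par (ι a)) * p.eval (enc (ι a)).length)]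

theorem Bdd.mul (h : Γ.Bdd c) (h' : Γ.Bdd c') : Γ.Bdd fun a => c a * c' a := by
  obtain ⟨f, p, hf, h⟩ := h
  obtain ⟨f', p', hf', h'⟩ := h'
  refine ⟨_, p * p', computable_mul hf hf', fun a ha => ?_⟩
  refine (Nat.mul_le_mul (h a ha) (h' a ha)).trans (le_of_eq ?_)
  simp only [Polynomial.eval_mul]
  ring

theorem Bdd.lift (h : Γ.Bdd c) (E : Ext Γ' Γ) : Γ'.Bdd fun x => c x.1 := by
  obtain ⟨f, p, hf, h⟩ := h
  exact ⟨f, p, hf, fun x hx => h x.1 (E.dom hx)⟩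

theorem Bdd.length : Γ.Bdd fun a => (enc (ι a)).length :=
  ⟨fun _ => 1, Polynomial.X, Computable.const 1, fun _ _ => by simp⟩

/-- The context inside a loop whose counter is kept in register `D + 2` and whose accumulator is
kept in register `D + 1`. -/
def loop (Γ : Ctx enc par ι) (D : ℕ) (b : α → ℕ) (acc : α → ℕ → ℕ) :
    Ctx enc par (fun x : α × ℕ => ι x.1) where
  depth := max Γ.depth (D + 3)
  ok x s := Γ.ok x.1 s ∧ s.reg (D + 1) = acc x.1 x.2 ∧ s.reg (D + 2) = x.2 ∧ x.2 < b x.1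
  frame := by
    rintro x s s' ⟨h1, h2, h3, h4⟩ hr hm
    refine ⟨Γ.frame h1 (fun i hi => hr i (lt_max_of_lt_left hi)) hm, ?_, ?_, h4⟩
    · rw [hr _ (lt_max_of_lt_right (by omega)), h2]
    · rw [hr _ (lt_max_of_lt_right (by omega)), h3]
  depth_pos := lt_max_of_lt_left Γ.depth_pos
  reg_zero h := Γ.reg_zero h.1
  mem_eq h := Γ.mem_eq h.1

theorem loop_ext (D : ℕ) (b : α → ℕ) (acc : α → ℕ → ℕ) : Ext (Γ.loop D b acc) Γ :=
  ⟨le_max_left _ _, fun h => h.1⟩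

end Ctx

open Ctx

/-! ### Elementary programs and bounded recursion. -/

namespace Comp

theorem congr (hf : Comp Γ f) (h : ∀ a, Γ.dom a → f a = g a) : Comp Γ g := by
  intro D hD
  obtain ⟨p, c, hc, H⟩ := hf D hD
  refine ⟨p, c, hc, fun a s hs => ?_⟩
  rw [← h a ⟨s, hs⟩]
  exact H a s hs

theorem lift (hf : Comp Γ f) (E : Ext Γ' Γ) : Comp Γ' fun x => f x.1 := by
  intro D hD
  obtain ⟨p, c, hc, H⟩ := hf D (E.depth_le.trans hD)
  exact ⟨p, fun x => c x.1, hc.lift E, fun x s hs => H x.1 s (E.ok hs)⟩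

theorem const (k : ℕ) : Comp Γ fun _ => k := by
  intro D _
  refine ⟨.assign D (.const k), fun _ => 2, Bdd.const 2, fun a s _ => ⟨_, _, .assign s D _, le_rfl,
    by simp [Expr.eval], fun i hi => by simp [hi.ne], rfl⟩⟩

theorem ofReg (i : ℕ) (h : ∀ a s, Γ.ok a s → s.reg i = f a) : Comp Γ f := by
  intro D _
  refine ⟨.assign D (.reg i), fun _ => 2, Bdd.const 2, fun a s hs => ⟨_, _, .assign s D _, le_rfl,
    by simp [Expr.eval, h a s hs], fun i hi => by simp [hi.ne], rfl⟩⟩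

theorem length : Comp Γ fun a => (enc (ι a)).length := ofReg 0 fun _ _ => Γ.reg_zero

theorem unary (e : ℕ → Expr) (op : α → ℕ → ℕ) (k : ℕ) (hk : ∀ i, (e i).cost ≤ k)
    (he : ∀ a s i, Γ.ok a s → (e i).eval s = op a (s.reg i)) (hf : Comp Γ f) :
    Comp Γ fun a => op a (f a) := by
  intro D hD
  obtain ⟨p, c, hc, H⟩ := hf D hD
  refine ⟨.seq p (.assign D (e D)), _, hc.add (Bdd.const (k + 1)), fun a s hs => ?_⟩
  obtain ⟨s', T, hr, hT, hD', hp, hm⟩ := H a s hs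
  have hs' := Γ.frame hs (fun i hi => hp i (hi.trans_le hD)) hm
  refine ⟨_, _, .seq hr (.assign s' D _), ?_, ?_, fun i hi => ?_, hm⟩
  · have := hk D
    omega
  · simp [he a s' D hs', hD']
  · simp [hi.ne, hp i hi]

theorem half (hf : Comp Γ f) : Comp Γ fun a => f a / 2 :=
  unary (fun i => .half (.reg i)) (fun _ x => x / 2) 2 (fun _ => le_rfl) (fun _ _ _ _ => rfl) hf

theorem read (hf : Comp Γ f) : Comp Γ fun a => letterAt (enc (ι a)) (f a) :=
  unary (fun i => .read (.reg i)) (fun a x => letterAt (enc (ι a)) x) 2 (fun _ => le_rfl)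
    (fun _ s i hs => by simp [Expr.eval, Γ.mem_eq hs]) hf

theorem binary (e : ℕ → ℕ → Expr) (op : ℕ → ℕ → ℕ) (k : ℕ) (hk : ∀ i j, (e i j).cost ≤ k)
    (he : ∀ s i j, (e i j).eval s = op (s.reg i) (s.reg j)) (hf : Comp Γ f) (hg : Comp Γ g) :
    Comp Γ fun a => op (f a) (g a) := by
  intro D hD
  obtain ⟨p, c, hc, H⟩ := hf D hD
  -- The second operand goes to the next register, so that computing it preserves the first one.
  obtain ⟨p', c', hc', H'⟩ := hg (D + 1) (hD.trans (Nat.le_succ D))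
  refine ⟨.seq p (.seq p' (.assign D (e D (D + 1)))), _, (hc.add hc').add (Bdd.const (k + 1)),
    fun a s hs => ?_⟩
  obtain ⟨s', T, hr, hT, hD', hp, hm⟩ := H a s hs
  have hs' := Γ.frame hs (fun i hi => hp i (hi.trans_le hD)) hm
  obtain ⟨s'', T', hr', hT', hD'', hp', hm'⟩ := H' a s' hs'
  refine ⟨_, _, .seq hr (.seq hr' (.assign s'' D _)), ?_, ?_, fun i hi => ?_, hm'.trans hm⟩
  · have := hk D (D + 1)
    omega
  · simp [he, hD'', hp' D (Nat.lt_succ_self D), hD']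
  · simp [hi.ne, hp i hi, hp' i (hi.trans (Nat.lt_succ_self D))]

theorem add (hf : Comp Γ f) (hg : Comp Γ g) : Comp Γ fun a => f a + g a :=
  binary (fun i j => .add (.reg i) (.reg j)) (· + ·) 3 (fun _ _ => le_rfl) (fun _ _ _ => rfl) hf hg

theorem sub (hf : Comp Γ f) (hg : Comp Γ g) : Comp Γ fun a => f a - g a :=
  binary (fun i j => .sub (.reg i) (.reg j)) (· - ·) 3 (fun _ _ => le_rfl) (fun _ _ _ => rfl) hf hg

theorem ite [DecidablePred P] (hP : CompP Γ P) (hf : Comp Γ f) (hg : Comp Γ g) :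
    Comp Γ fun a => if P a then f a else g a := by
  obtain ⟨u, hu, hP⟩ := hP
  intro D hD
  obtain ⟨p, c, hc, H⟩ := hu D hD
  obtain ⟨p₁, c₁, hc₁, H₁⟩ := hf D hD
  obtain ⟨p₂, c₂, hc₂, H₂⟩ := hg D hD
  refine ⟨.seq p (.branch (.reg D) p₁ p₂), _, ((hc.add hc₁).add hc₂).add (Bdd.const 2),
    fun a s hs => ?_⟩
  obtain ⟨s', T, hr, hT, hD', hp, hm⟩ := H a s hs
  have hs' := Γ.frame hs (fun i hi => hp i (hi.trans_le hD)) hm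
  have hPa := hP a ⟨s, hs⟩
  by_cases hu0 : u a = 0
  · have hnP : ¬ P a := fun h => hPa.2 h hu0
    obtain ⟨s'', T', hr', hT', hD'', hp', hm'⟩ := H₂ a s' hs'
    refine ⟨_, _, .seq hr (.branch_false (by simp [Expr.eval, hD', hu0]) hr'), ?_, ?_,
      fun i hi => (hp' i hi).trans (hp i hi), hm'.trans hm⟩
    · simp only [Expr.cost]
      omega
    · simp [hD'', hnP]
  · have hnP : P a := hPa.1 hu0
    obtain ⟨s'', T', hr', hT', hD'', hp', hm'⟩ := H₁ a s' hs'
    refine ⟨_, _, .seq hr (.branch_true (by simp [Expr.eval, hD', hu0]) hr'), ?_, ?_,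
      fun i hi => (hp' i hi).trans (hp i hi), hm'.trans hm⟩
    · simp only [Expr.cost]
      omega
    · simp [hD'', hnP]

/-- Register `D` holds the number of rounds, `D + 1` the accumulator, `D + 2` the counter, and the
body `p` leaves the new accumulator in `D + 3`. Beyond the body, a round costs 4 for the guard and 2
+ 4 for the two updates; the last guard costs another 4. The induction is on the number `r` of
rounds left. -/
theorem run_loop {acc : α → ℕ → ℕ} {D C : ℕ} {p : Program} {a : α} (hD : Γ.depth ≤ D)
    (H : ∀ i s, (Γ.loop D b acc).ok (a, i) s → ∃ s' T, Run p s s' T ∧ T ≤ C ∧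
      s'.reg (D + 3) = acc a (i + 1) ∧ (∀ j < D + 3, s'.reg j = s.reg j) ∧ s'.mem = s.mem) (r : ℕ) :
    ∀ i s, i + r = b a → Γ.ok a s → s.reg D = b a → s.reg (D + 1) = acc a i → s.reg (D + 2) = i →
      ∃ s' T, Run (.loop (.sub (.reg D) (.reg (D + 2))) (.seq p (.seq (.assign (D + 1) (.reg (D + 3)))
          (.assign (D + 2) (.add (.reg (D + 2)) (.const 1)))))) s s' T ∧ T ≤ r * (C + 10) + 4 ∧
        s'.reg (D + 1) = acc a (b a) ∧ (∀ j < D, s'.reg j = s.reg j) ∧ s'.mem = s.mem := by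
  induction r with
  | zero =>
    intro i s hi hs h0 h1 h2
    refine ⟨s, _, .loop_done ?_, ?_, ?_, fun _ _ => rfl, rfl⟩
    · simp only [Expr.eval, h0, h2]
      omega
    · simp [Expr.cost]
    · rw [h1, ← hi, Nat.add_zero]
  | succ r ih =>
    intro i s hi hs h0 h1 h2
    obtain ⟨s₁, T₁, hr, hT, hv, hp, hm⟩ := H i s ⟨hs, h1, h2, by simp only; omega⟩
    have hs₁ : Γ.ok a s₁ := Γ.frame hs (fun j hj => hp j (by omega)) hm
    obtain ⟨s₃, T₃, hr₃, hT₃, hv₃, hp₃, hm₃⟩ := ih (i + 1)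
      ⟨Function.update (Function.update s₁.reg (D + 1) (s₁.reg (D + 3))) (D + 2)
        (s₁.reg (D + 2) + 1), s₁.mem⟩ (by omega)
      (Γ.frame hs₁ (fun j hj => by
        have h1 : j ≠ D + 1 := by omega
        have h2 : j ≠ D + 2 := by omega
        simp [h1, h2]) rfl)
      (by simp [hp D (by omega), h0]) (by simp [hv]) (by simp [hp (D + 2) (by omega), h2])
    refine ⟨s₃, _, .loop_step (T' := T₃) ?_ (.seq hr (.seq (.assign _ _ _) (.assign _ _ _))) ?_, ?_,
      hv₃, ?_, ?_⟩
    · simp only [Expr.eval, h0, h2]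
      omega
    · simpa [Expr.eval] using hr₃
    · simp only [Expr.cost]
      have : (r + 1) * (C + 10) = r * (C + 10) + (C + 10) := by ring
      omega
    · intro j hj
      have h1 : j ≠ D + 1 := by omega
      have h2 : j ≠ D + 2 := by omega
      rw [hp₃ j hj]
      simp [h1, h2, hp j (by omega)]
    · rw [hm₃, hm]

/-- Bounded recursion. -/
theorem fold {acc : α → ℕ → ℕ} (hb : Comp Γ b) (hB : Γ.Bdd b) (h0 : Comp Γ fun a => acc a 0)
    (hs : Under Γ b fun Γ' =>
      Comp Γ' (fun x => acc x.1 x.2) → Comp Γ' fun x => acc x.1 (x.2 + 1)) :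
    Comp Γ fun a => acc a (b a) := by
  intro D hD
  have hbody := hs (Γ.loop D b acc) (loop_ext D b acc) (fun x ⟨s, h⟩ => h.2.2.2)
    (ofReg (D + 2) fun a s h => h.2.2.1) (ofReg (D + 1) fun a s h => h.2.1)
  obtain ⟨pb, cb, hcb, Hb⟩ := hb D hD
  obtain ⟨p0, c0, hc0, H0⟩ := h0 (D + 1) (by omega)
  -- The parameter and the input length do not depend on the counter, so this bound on the cost of
  -- the body is the same in all rounds.
  obtain ⟨p, c, ⟨F, q, hF, hc⟩, H⟩ := hbody (D + 3) (max_le (by omega) le_rfl)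
  have hC : Γ.Bdd fun a => F (par (ι a)) * q.eval (enc (ι a)).length :=
    ⟨F, q, hF, fun _ _ => le_rfl⟩
  refine ⟨.seq pb (.seq p0 (.seq (.assign (D + 2) (.const 0)) (.seq (.loop
    (.sub (.reg D) (.reg (D + 2))) (.seq p (.seq (.assign (D + 1) (.reg (D + 3)))
          (.assign (D + 2) (.add (.reg (D + 2)) (.const 1)))))) (.assign D (.reg (D + 1)))))), _,
    ((hcb.add hc0).add (hB.mul (hC.add (Bdd.const 10)))).add (Bdd.const 8), fun a s hs => ?_⟩
  obtain ⟨s₁, T₁, hr₁, hT₁, hv₁, hp₁, hm₁⟩ := Hb a s hs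
  have hs₁ := Γ.frame hs (fun i hi => hp₁ i (hi.trans_le hD)) hm₁
  obtain ⟨s₂, T₂, hr₂, hT₂, hv₂, hp₂, hm₂⟩ := H0 a s₁ hs₁
  have hs₂ := Γ.frame hs₁ (fun i hi => hp₂ i (by omega)) hm₂
  obtain ⟨s₃, T₃, hr₃, hT₃, hv₃, hp₃, hm₃⟩ := run_loop (Γ := Γ) (b := b) (acc := acc) (D := D)
    (C := F (par (ι a)) * q.eval (enc (ι a)).length) (p := p) (a := a) hD
    (fun i s h => by
      obtain ⟨s', T, h1, h2, h3⟩ := H (a, i) s h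
      exact ⟨s', T, h1, h2.trans (hc (a, i) ⟨s, h⟩), h3⟩) (b a) 0
    ⟨Function.update s₂.reg (D + 2) 0, s₂.mem⟩ (by omega)
    (Γ.frame hs₂ (fun i hi => by
      have : i ≠ D + 2 := by omega
      simp [this]) rfl)
    (by simp [hp₂ D (by omega), hv₁]) (by simp [hv₂]) (by simp)
  refine ⟨_, _, .seq hr₁ (.seq hr₂ (.seq (.assign _ _ _) (.seq hr₃ (.assign _ _ _)))), ?_, ?_, ?_, ?_⟩
  · simp only [Expr.cost]
    omega
  · simp [Expr.eval, hv₃]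
  · intro i hi
    have h2 : i ≠ D + 2 := by omega
    simp [hi.ne, hp₃ i hi, h2, hp₂ i (by omega), hp₁ i hi]
  · simp [hm₃, hm₂, hm₁]

end Comp

end RAM

/-! ### Predicates, bounded quantifiers, and arithmetic with large numbers. -/

namespace RAM

variable {I : Type} {enc : I → List (Fin 3)} {par : I → ℕ} {α : Type} {ι : α → I}
  {Γ : Ctx enc par ι} {Γ' : Ctx enc par (fun x : α × ℕ => ι x.1)}
  {f g h b : α → ℕ} {P Q : α → Prop} {R : α → ℕ → Prop}

open Ctx

namespace CompP

theorem congr (hP : CompP Γ P) (h : ∀ a, Γ.dom a → (P a ↔ Q a)) : CompP Γ Q := by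
  obtain ⟨f, hf, hP⟩ := hP
  exact ⟨f, hf, fun a ha => (hP a ha).trans (h a ha)⟩

theorem lt (hf : Comp Γ f) (hg : Comp Γ g) : CompP Γ fun a => f a < g a :=
  ⟨_, hg.sub hf, fun a _ => by omega⟩

theorem le (hf : Comp Γ f) (hg : Comp Γ g) : CompP Γ fun a => f a ≤ g a :=
  ⟨_, (hg.add (.const 1)).sub hf, fun a _ => by omega⟩

theorem eq (hf : Comp Γ f) (hg : Comp Γ g) : CompP Γ fun a => f a = g a :=
  ⟨_, (Comp.const 1).sub ((hf.sub hg).add (hg.sub hf)), fun a _ => by omega⟩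

theorem not (hP : CompP Γ P) : CompP Γ fun a => ¬ P a := by
  obtain ⟨f, hf, hP⟩ := hP
  refine ⟨_, (Comp.const 1).sub hf, fun a ha => ?_⟩
  simp only [← hP a ha]
  omega

theorem or (hP : CompP Γ P) (hQ : CompP Γ Q) : CompP Γ fun a => P a ∨ Q a := by
  obtain ⟨f, hf, hP⟩ := hP
  obtain ⟨g, hg, hQ⟩ := hQ
  refine ⟨_, hf.add hg, fun a ha => ?_⟩
  simp only [← hP a ha, ← hQ a ha]
  omega

theorem and (hP : CompP Γ P) (hQ : CompP Γ Q) : CompP Γ fun a => P a ∧ Q a :=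
  (hP.not.or hQ.not).not.congr fun a _ => by tauto

theorem imp (hP : CompP Γ P) (hQ : CompP Γ Q) : CompP Γ fun a => P a → Q a :=
  (hP.not.or hQ).congr fun a _ => by tauto

theorem iff (hP : CompP Γ P) (hQ : CompP Γ Q) : CompP Γ fun a => P a ↔ Q a :=
  ((hP.imp hQ).and (hQ.imp hP)).congr fun a _ => by tauto

end CompP

namespace Comp

theorem count [∀ a, DecidablePred (R a)] (hb : Comp Γ b) (hB : Γ.Bdd b)
    (hR : Under Γ b fun Γ' => CompP Γ' fun x => R x.1 x.2) :
    Comp Γ fun a => Nat.count (R a) (b a) := by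
  refine fold (acc := fun a i => Nat.count (R a) i) hb hB (by simpa using const 0)
    fun Γ' E hi hx hacc => ?_
  simp only [Nat.count_succ]
  exact hacc.add (ite (hR Γ' E hi hx) (const 1) (const 0))

/-- Repeated addition: only the second factor, the number of rounds, has to be bounded, while the
first may be huge. -/
theorem mul (hf : Comp Γ f) (hg : Comp Γ g) (hB : Γ.Bdd g) : Comp Γ fun a => f a * g a := by
  refine fold (acc := fun a i => f a * i) hg hB (by simpa using const 0) fun Γ' E hi hx hacc => ?_
  simp only [Nat.mul_succ]
  exact hacc.add (hf.lift E)

theorem mul_two_pow (hf : Comp Γ f) (hg : Comp Γ g) (hB : Γ.Bdd g) :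
    Comp Γ fun a => f a * 2 ^ g a := by
  refine fold (acc := fun a i => f a * 2 ^ i) hg hB (by simpa using hf) fun Γ' E hi hx hacc => ?_
  refine (hacc.add hacc).congr fun x _ => ?_
  ring

theorem two_pow (hg : Comp Γ g) (hB : Γ.Bdd g) : Comp Γ fun a => 2 ^ g a := by
  simpa using mul_two_pow (const 1) hg hB

theorem div_two_pow (hf : Comp Γ f) (hg : Comp Γ g) (hB : Γ.Bdd g) :
    Comp Γ fun a => f a / 2 ^ g a := by
  refine fold (acc := fun a i => f a / 2 ^ i) hg hB (by simpa using hf) fun Γ' E hi hx hacc => ?_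
  refine hacc.half.congr fun x _ => ?_
  rw [pow_succ, Nat.div_div_eq_div_mul]

/-- One step of binary long division: a remainder modulo `2y` exceeds its remainder modulo `y` by
`0` or `y`. -/
theorem mod_mul_two_pow (x L n : ℕ) :
    x % (L * 2 ^ n) = if L * 2 ^ n ≤ x % (L * 2 ^ (n + 1)) then x % (L * 2 ^ (n + 1)) - L * 2 ^ n
      else x % (L * 2 ^ (n + 1)) := by
  have h2 : L * 2 ^ (n + 1) = L * 2 ^ n * 2 := by ring
  rw [h2]
  generalize L * 2 ^ n = y
  rw [Nat.mod_mul]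
  rcases Nat.eq_zero_or_pos y with rfl | hy
  · simp
  have h1 := Nat.mod_lt x hy
  rcases Nat.mod_two_eq_zero_or_one (x / y) with h | h <;> rw [h]
  · rw [if_neg (by omega)]
    omega
  · rw [if_pos (by omega)]
    omega

/-- The remainder of a large number, whose number of bits is bounded. -/
theorem mod (hf : Comp Γ f) (hg : Comp Γ g) (hb : Comp Γ b) (hB : Γ.Bdd b)
    (hfb : ∀ a, Γ.dom a → f a < 2 ^ b a) : Comp Γ fun a => f a % g a := by
  -- The accumulator is the remainder modulo `g a * 2 ^ (b a - i)`. It starts as `f a`, which is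
  -- less than `2 ^ b a` (and `x % 0 = x` covers `g a = 0`); after `b a` rounds the modulus is `g
  -- a`.
  have key : Comp Γ fun a => f a % (g a * 2 ^ (b a - b a)) := by
    refine fold (acc := fun a i => f a % (g a * 2 ^ (b a - i))) hb hB (hf.congr fun a ha => ?_)
      fun Γ' E hi hx hacc => ?_
    · simp only [Nat.sub_zero]
      rcases Nat.eq_zero_or_pos (g a) with h | h
      · simp [h]
      · rw [Nat.mod_eq_of_lt ((hfb a ha).trans_le (Nat.le_mul_of_pos_left _ h))]
    · have hy : Comp Γ' fun x => g x.1 * 2 ^ (b x.1 - (x.2 + 1)) :=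
        (hg.lift E).mul_two_pow ((hb.lift E).sub (hx.add (const 1)))
          ((hB.lift E).mono fun x _ => Nat.sub_le _ _)
      refine (ite (.le hy hacc) (hacc.sub hy) hacc).congr fun x hxd => ?_
      have := hi x hxd
      rw [mod_mul_two_pow (f x.1) (g x.1) (b x.1 - (x.2 + 1)),
        show b x.1 - (x.2 + 1) + 1 = b x.1 - x.2 by omega]
  simpa using key

theorem mod_of_bdd (hf : Comp Γ f) (hB : Γ.Bdd f) (hg : Comp Γ g) : Comp Γ fun a => f a % g a :=
  mod hf hg hf hB fun _ _ => Nat.lt_two_pow_self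

theorem count_lt_eq {x y : ℕ} (h : x ≤ y) : Nat.count (· < x) y = x := by
  rw [Nat.count_eq_card_filter_range, show (Finset.range y).filter (· < x) = Finset.range x by
    ext i; simp; omega, Finset.card_range]

/-- The quotient is the number of `i` with `g * (i + 1) ≤ f`; for bounded `f` these can be counted
one by one. -/
theorem div (hf : Comp Γ f) (hB : Γ.Bdd f) (hg : Comp Γ g) (hpos : ∀ a, Γ.dom a → 0 < g a) :
    Comp Γ fun a => f a / g a := by
  classical
  refine (count (R := fun a i => i < f a / g a) hf hB fun Γ' E hi hx => ?_).congr fun a _ =>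
    count_lt_eq (Nat.div_le_self _ _)
  refine (CompP.le ((hg.lift E).mul (hx.add (const 1)) ?_) (hf.lift E)).congr fun x hxd => ?_
  · exact (hB.lift E).mono fun x hxd => hi x hxd
  · rw [Nat.lt_iff_add_one_le, Nat.le_div_iff_mul_le (hpos _ (E.dom hxd)), mul_comm]

theorem max (hf : Comp Γ f) (hg : Comp Γ g) : Comp Γ fun a => max (f a) (g a) :=
  (hf.add (hg.sub hf)).congr fun a _ => by omega

theorem min (hf : Comp Γ f) (hg : Comp Γ g) : Comp Γ fun a => min (f a) (g a) :=
  (hf.sub (hf.sub hg)).congr fun a _ => by omega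

theorem sup {F : α → ℕ → ℕ} (hb : Comp Γ b) (hB : Γ.Bdd b)
    (hF : Under Γ b fun Γ' => Comp Γ' fun x => F x.1 x.2) :
    Comp Γ fun a => (Finset.range (b a)).sup (F a) := by
  refine fold (acc := fun a i => (Finset.range i).sup (F a)) hb hB (by simpa using const 0)
    fun Γ' E hi hx hacc => ?_
  refine ((hF Γ' E hi hx).max hacc).congr fun x _ => ?_
  rw [Finset.range_add_one, Finset.sup_insert]

end Comp

namespace CompP

theorem testBit (hf : Comp Γ f) (hg : Comp Γ g) (hB : Γ.Bdd g) :
    CompP Γ fun a => (f a).testBit (g a) = true := by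
  have h := hf.div_two_pow hg hB
  refine (eq (h.sub (h.half.add h.half)) (.const 1)).congr fun a _ => ?_
  rw [Nat.testBit_eq_decide_div_mod_eq]
  simp only [decide_eq_true_eq]
  omega

theorem ex (hb : Comp Γ b) (hB : Γ.Bdd b)
    (hR : Under Γ b fun Γ' => CompP Γ' fun x => R x.1 x.2) :
    CompP Γ fun a => ∃ i < b a, R a i := by
  classical
  refine ⟨_, Comp.count hb hB hR, fun a _ => ?_⟩
  rw [Nat.count_eq_card_filter_range, Finset.card_ne_zero]
  simp [Finset.Nonempty]

theorem all (hb : Comp Γ b) (hB : Γ.Bdd b)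
    (hR : Under Γ b fun Γ' => CompP Γ' fun x => R x.1 x.2) :
    CompP Γ fun a => ∀ i < b a, R a i :=
  (ex (R := fun a i => ¬ R a i) hb hB fun Γ' E hi hx => (hR Γ' E hi hx).not).not.congr fun a _ => by
    push Not
    rfl

end CompP

/-- The context at the start of the computation. -/
def initCtx (enc : I → List (Fin 3)) (par : I → ℕ) : Ctx enc par (fun x : I => x) where
  depth := 1
  ok x s := s.reg 0 = (enc x).length ∧ s.mem = letterAt (enc x)
  frame h hr hm := ⟨(hr 0 Nat.one_pos).trans h.1, hm.trans h.2⟩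
  depth_pos := Nat.one_pos
  reg_zero h := h.1
  mem_eq h := h.2

end RAM

theorem ParamProblem.isFPT_of_compP (P : ParamProblem)
    (h : RAM.CompP (RAM.initCtx P.encode P.param) P.Yes) : P.IsFPT := by
  classical
  -- The answer is computed in register `1`, because register `0` must keep the input length until
  -- the end.
  obtain ⟨p, c, ⟨f, q, hf, hc⟩, H⟩ := RAM.Comp.ite h (.const 1) (.const 0) 1 le_rfl
  refine ⟨.seq p (.assign 0 (.reg 1)), fun k => f k + 2, q + 1,
    RAM.Ctx.computable_add hf (Computable.const 2), fun x => ?_⟩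
  have hok : (RAM.initCtx P.encode P.param).ok x (RAM.State.init (P.encode x)) := ⟨rfl, rfl⟩
  obtain ⟨s, T, hr, hT, hs, -, -⟩ := H x _ hok
  refine ⟨_, _, .seq hr (.assign _ _ _), ?_, fun hY => ?_, fun hN => ?_⟩
  · have := hc x ⟨_, hok⟩
    simp only [Polynomial.eval_add, Polynomial.eval_one, RAM.Expr.cost]
    nlinarith
  · simp [RAM.Expr.eval, hs, hY]
  · simp [RAM.Expr.eval, hs, hN]

/-! ### Simultaneous congruences and incongruences -/

namespace Periodic

/-- An exponential sum with `n` terms that vanishes at `0, …, n - 1` vanishes everywhere. -/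
theorem expSum_eq_zero {σ : Type*} (s : Finset σ) (c β : σ → ℂ)
    (h : ∀ x < s.card, ∑ i ∈ s, c i * β i ^ x = 0) (x : ℕ) : ∑ i ∈ s, c i * β i ^ x = 0 := by
  induction x using Nat.strong_induction_on with
  | _ x ih =>
    rcases lt_or_ge x s.card with hx | hx
    · exact h x hx
    obtain ⟨y, rfl⟩ := Nat.exists_eq_add_of_le' hx
    -- The coefficients of the monic polynomial with roots `β i` give a linear recurrence of order
    -- `s.card`, which expresses the value at `y + s.card` by the `s.card` preceding ones.
    let P : Polynomial ℂ := ∏ i ∈ s, (Polynomial.X - Polynomial.C (β i))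
    have hdeg : P.natDegree = s.card := by
      simp [P]
    have hmon : P.coeff s.card = 1 := by
      rw [← hdeg]
      exact Polynomial.monic_prod_of_monic s _ fun i _ => Polynomial.monic_X_sub_C _
    have hroot : ∀ i ∈ s, P.eval (β i) = 0 := fun i hi => by
      simp only [P, Polynomial.eval_prod]
      exact Finset.prod_eq_zero hi (by simp)
    have hsum : ∑ k ∈ Finset.range (s.card + 1), P.coeff k * ∑ i ∈ s, c i * β i ^ (y + k) = 0 := by
      simp only [Finset.mul_sum]
      rw [Finset.sum_comm]
      refine Finset.sum_eq_zero fun i hi => ?_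
      have := hroot i hi
      rw [Polynomial.eval_eq_sum_range, hdeg] at this
      calc ∑ k ∈ Finset.range (s.card + 1), P.coeff k * (c i * β i ^ (y + k))
          = c i * β i ^ y * ∑ k ∈ Finset.range (s.card + 1), P.coeff k * β i ^ k := by
            rw [Finset.mul_sum]
            exact Finset.sum_congr rfl fun k _ => by ring
        _ = 0 := by rw [this, mul_zero]
    rw [Finset.sum_range_succ, hmon, one_mul, Finset.sum_eq_zero, zero_add] at hsum
    · exact hsum
    · intro k hk
      rw [ih (y + k) (by have := Finset.mem_range.1 hk; omega), mul_zero]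

/-- If finitely many residue classes do not contain all terms of an arithmetic progression, they do
not contain all of its first `2 ^ n` terms, where `n` is their number. -/
theorem exists_lt_two_pow_avoiding {σ : Type*} (s : Finset σ) (L p : σ → ℕ) (hL : ∀ i ∈ s, p i < L i)
    (r M x : ℕ) (hx : ∀ i ∈ s, (r + x * M) % L i ≠ p i) :
    ∃ j < 2 ^ s.card, ∀ i ∈ s, (r + j * M) % L i ≠ p i := by
  classical
  let ζ : σ → ℂ := fun i => Complex.exp (2 * Real.pi * Complex.I / L i)
  have hζ : ∀ i ∈ s, IsPrimitiveRoot (ζ i) (L i) := fun i hi =>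
    Complex.isPrimitiveRoot_exp _ (by have := hL i hi; omega)
  -- Since `ζ i` is a primitive `L i`-th root of unity, lying in the `i`-th class means that a
  -- binomial in `ζ i` vanishes. A term avoids all classes iff the product of these binomials is
  -- nonzero.
  have hiff : ∀ y, ∀ i ∈ s, ((r + y * M) % L i = p i ↔
      -(ζ i ^ r) * (ζ i ^ M) ^ y + ζ i ^ p i = 0) := by
    intro y i hi
    have h1 : -(ζ i ^ r) * (ζ i ^ M) ^ y + ζ i ^ p i = ζ i ^ p i - ζ i ^ (r + y * M) := by
      rw [pow_add, mul_comm y, pow_mul]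
      ring
    rw [h1, sub_eq_zero, ← pow_mod_orderOf (ζ i) (r + y * M), ← (hζ i hi).eq_orderOf]
    exact ⟨fun h => by rw [h], fun h => ((hζ i hi).pow_inj (hL i hi)
      (Nat.mod_lt _ ((Nat.zero_le _).trans_lt (hL i hi))) h).symm⟩
  -- Expanded over subsets of `s`, the product is an exponential sum in `y` with `2 ^ s.card` terms.
  have hexp : ∀ y, ∏ i ∈ s, (-(ζ i ^ r) * (ζ i ^ M) ^ y + ζ i ^ p i) =
      ∑ t ∈ s.powerset, ((∏ i ∈ t, -(ζ i ^ r)) * ∏ i ∈ s \ t, ζ i ^ p i) *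
        (∏ i ∈ t, ζ i ^ M) ^ y := by
    intro y
    rw [Finset.prod_add]
    refine Finset.sum_congr rfl fun t _ => ?_
    rw [Finset.prod_mul_distrib, Finset.prod_pow]
    ring
  by_contra hcon
  push Not at hcon
  have hzero := expSum_eq_zero s.powerset
    (fun t => (∏ i ∈ t, -(ζ i ^ r)) * ∏ i ∈ s \ t, ζ i ^ p i) (fun t => ∏ i ∈ t, ζ i ^ M)
    (fun y hy => by
      rw [Finset.card_powerset] at hy
      obtain ⟨i, hi, h⟩ := hcon y hy
      rw [← hexp]
      exact Finset.prod_eq_zero hi ((hiff y i hi).1 h)) x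
  rw [← hexp, Finset.prod_eq_zero_iff] at hzero
  obtain ⟨i, hi, h⟩ := hzero
  exact hx i hi ((hiff x i hi).2 h)

/-! ### Solving congruences by search. -/

/-- Search, with at most `n` steps, for the first number in `x, x + M, x + 2M, …` that leaves
remainder `p` modulo `L`. -/
def search (M L p x : ℕ) : ℕ → ℕ
  | 0 => x
  | n + 1 => if search M L p x n % L = p then search M L p x n else search M L p x n + M

theorem search_spec (M L p x n : ℕ) : ∃ i ≤ n, search M L p x n = x + i * M ∧
    (∀ k < i, (x + k * M) % L ≠ p) ∧ (i = n ∨ (x + i * M) % L = p) := by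
  induction n with
  | zero => exact ⟨0, le_rfl, by simp [search], by simp, .inl rfl⟩
  | succ n ih =>
    obtain ⟨i, hin, hs, hmin, h⟩ := ih
    rw [search, hs]
    by_cases hp : (x + i * M) % L = p
    · exact ⟨i, by omega, by rw [if_pos hp], hmin, .inr hp⟩
    · obtain rfl : i = n := h.resolve_right hp
      refine ⟨i + 1, le_rfl, by rw [if_neg hp]; ring, fun k hk => ?_, .inl rfl⟩
      rcases Nat.lt_succ_iff_lt_or_eq.1 hk with hk | rfl
      exacts [hmin k hk, hp]

theorem search_le (M L p x n : ℕ) : search M L p x n ≤ x + n * M := by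
  obtain ⟨i, hi, h, -⟩ := search_spec M L p x n
  rw [h]
  exact Nat.add_le_add_left (Nat.mul_le_mul_right M hi) x

theorem search_eq {M L p x k : ℕ} (hk : k < L) (h : (x + k * M) % L = p) :
    ∃ i ≤ k, search M L p x L = x + i * M ∧ (x + i * M) % L = p := by
  obtain ⟨i, hi, hs, hmin, hor⟩ := search_spec M L p x L
  have hik : i ≤ k := not_lt.1 fun hlt => hmin k hlt h
  exact ⟨i, hik, hs, hor.resolve_left (by omega)⟩

/-- The least common multiple is the first multiple of `L` among `M, 2M, …`, and `L M` is such a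
multiple. The search starts at `M`, hence the index `k - 1` for `k M`. -/
theorem search_lcm {M L : ℕ} (hM : 0 < M) (hL : 0 < L) : search M L 0 M L = Nat.lcm M L := by
  obtain ⟨k, hk⟩ := Nat.dvd_lcm_left M L
  have hpos := Nat.lcm_pos hM hL
  have hk0 : 0 < k := Nat.pos_of_ne_zero fun h => by simp [h] at hk; omega
  have hkL : k ≤ L := by
    have := Nat.le_of_dvd (Nat.mul_pos hM hL) (Nat.lcm_dvd_mul M L)
    rw [hk] at this
    exact Nat.le_of_mul_le_mul_left this hM
  have hhit : (M + (k - 1) * M) % L = 0 := by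
    have : M + (k - 1) * M = M * k := by
      obtain ⟨k, rfl⟩ := Nat.exists_eq_add_of_le' hk0
      simp
      ring
    rw [this, ← hk]
    exact Nat.mod_eq_zero_of_dvd (Nat.dvd_lcm_right M L)
  obtain ⟨i, hi, hs, h0⟩ := search_eq (by omega) hhit
  rw [hs]
  refine Nat.le_antisymm ?_ (Nat.le_of_dvd (by positivity) (Nat.lcm_dvd ?_ (Nat.dvd_of_mod_eq_zero h0)))
  · rw [hk]
    calc M + i * M = M * (i + 1) := by ring
      _ ≤ M * k := Nat.mul_le_mul_left M (by omega)
  · exact ⟨i + 1, by ring⟩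

variable (sel : ℕ → Prop) [DecidablePred sel] (L p : ℕ → ℕ)

/-- The least common multiple of the selected moduli. -/
def modulus : ℕ → ℕ
  | 0 => 1
  | e + 1 => if sel e then search (modulus e) (L e) 0 (modulus e) (L e) else modulus e

/-- A solution of the selected congruences, if there is one. -/
def residue : ℕ → ℕ
  | 0 => 0
  | e + 1 => if sel e then search (modulus sel L e) (L e) (p e) (residue e) (L e) else residue e

/-- The time `t` may lie below the start `r` of the progression. Adding a multiple of `M * Λ` lifts
it into the progression without changing its residues modulo `M` and the divisors of `Λ`. -/
theorem exists_add_mul_eq {r t M Λ : ℕ} (hM : 0 < M) (hΛ : 0 < Λ) (h : t ≡ r [MOD M]) :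
    ∃ x y, r + x * M = t + y * (M * Λ) := by
  have h' : r ≡ t + r * (M * Λ) [MOD M] := by
    have : r * (M * Λ) ≡ 0 [MOD M] := (Nat.modEq_zero_iff_dvd).2 ⟨r * Λ, by ring⟩
    simpa using h.symm.add this.symm
  have hle : r ≤ t + r * (M * Λ) :=
    (Nat.le_mul_of_pos_right r (Nat.mul_pos hM hΛ)).trans (Nat.le_add_left _ _)
  obtain ⟨x, hx⟩ := (Nat.modEq_iff_dvd' hle).1 h'
  exact ⟨x, r, by rw [mul_comm x]; omega⟩

theorem residue_spec {t : ℕ} (hsel : ∀ e, sel e → p e < L e ∧ t % L e = p e) (e : ℕ) :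
    0 < modulus sel L e ∧ t ≡ residue sel L p e [MOD modulus sel L e] ∧
      ∀ i < e, sel i → L i ∣ modulus sel L e := by
  induction e with
  | zero => exact ⟨Nat.one_pos, Nat.modEq_one, by simp⟩
  | succ e ih =>
    obtain ⟨hM, ht, hdvd⟩ := ih
    rw [modulus, residue]
    by_cases hs : sel e
    · obtain ⟨hp, hte⟩ := hsel e hs
      have hL : 0 < L e := by omega
      simp only [if_pos hs]
      rw [search_lcm hM hL]
      refine ⟨Nat.lcm_pos hM hL, ?_, fun i hi hsi => ?_⟩
      · obtain ⟨x, y, hxy⟩ := exists_add_mul_eq hM hL ht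
        -- A lift of `t` is a term of the progression and satisfies the new congruence; as residues
        -- modulo `L e` recur with period `L e`, so does a term of index less than `L e`, within
        -- reach of the search.
        have hhit : (residue sel L p e + x % L e * modulus sel L e) % L e = p e := by
          have h1 : residue sel L p e + x % L e * modulus sel L e ≡
              residue sel L p e + x * modulus sel L e [MOD L e] :=
            ((Nat.mod_modEq x (L e)).mul_right _).add_left _
          have h2 : t + y * (modulus sel L e * L e) ≡ t [MOD L e] := by
            have : y * (modulus sel L e * L e) ≡ 0 [MOD L e] :=
              (Nat.modEq_zero_iff_dvd).2 ⟨y * modulus sel L e, by ring⟩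
            simpa using (Nat.ModEq.refl t).add this
          rw [← hte]
          exact h1.trans (hxy ▸ h2)
        obtain ⟨i, -, hi, hip⟩ := search_eq (Nat.mod_lt x hL) hhit
        rw [hi]
        refine Nat.mod_lcm ?_ (hte.trans hip.symm)
        refine ht.trans ?_
        simp
      · rcases Nat.lt_succ_iff_lt_or_eq.1 hi with hi | rfl
        · exact (hdvd i hi hsi).trans (Nat.dvd_lcm_left _ _)
        · exact Nat.dvd_lcm_right _ _
    · simp only [if_neg hs]
      refine ⟨hM, ht, fun i hi hsi => ?_⟩
      rcases Nat.lt_succ_iff_lt_or_eq.1 hi with hi | rfl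
      exacts [hdvd i hi hsi, absurd hsi hs]

variable {L p}

/-- Each selected modulus multiplies the bound by at most `L e + 1 ≤ 2 ^ N`, that is, costs at most
`N` bits. -/
theorem modulus_le {N : ℕ} (hN : ∀ e, L e ≤ N) (e : ℕ) : modulus sel L e ≤ 2 ^ (N * e) := by
  induction e with
  | zero => simp [modulus]
  | succ e ih =>
    have h2 : 2 ^ (N * (e + 1)) = 2 ^ (N * e) * 2 ^ N := by rw [← pow_add]; ring_nf
    have hN2 : L e + 1 ≤ 2 ^ N := ((Nat.add_le_add_right (hN e) 1).trans Nat.lt_two_pow_self)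
    rw [modulus, h2]
    split_ifs
    · refine (search_le _ _ _ _ _).trans ?_
      calc modulus sel L e + L e * modulus sel L e = modulus sel L e * (L e + 1) := by ring
        _ ≤ _ := Nat.mul_le_mul ih hN2
    · exact ih.trans (Nat.le_mul_of_pos_right _ (by positivity))

/-- All `n ≤ L e` are covered because running a search takes remainders of every intermediate value,
whose bit length must be controlled. -/
theorem search_residue_le {N : ℕ} (hN : ∀ e, L e ≤ N) {r e n : ℕ} (hr : r ≤ 2 ^ (N * e)) (q : ℕ)
    (hn : n ≤ L e) : search (modulus sel L e) (L e) q r n ≤ 2 ^ (N * (e + 1)) := by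
  have h2 : 2 ^ (N * (e + 1)) = 2 ^ (N * e) * 2 ^ N := by rw [← pow_add]; ring_nf
  have hN2 : n + 1 ≤ 2 ^ N := (Nat.add_le_add_right (hn.trans (hN e)) 1).trans Nat.lt_two_pow_self
  calc _ ≤ r + n * modulus sel L e := search_le _ _ _ _ _
    _ ≤ 2 ^ (N * e) + n * 2 ^ (N * e) :=
      Nat.add_le_add hr (Nat.mul_le_mul_left n (modulus_le sel hN e))
    _ = 2 ^ (N * e) * (n + 1) := by ring
    _ ≤ _ := by rw [h2]; exact Nat.mul_le_mul_left _ hN2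

theorem residue_le {N : ℕ} (hN : ∀ e, L e ≤ N) (e : ℕ) : residue sel L p e ≤ 2 ^ (N * e) := by
  induction e with
  | zero => simp [residue]
  | succ e ih =>
    rw [residue]
    split_ifs
    · exact search_residue_le sel hN ih _ le_rfl
    · exact ih.trans (Nat.pow_le_pow_right (by norm_num) (Nat.mul_le_mul_left N (Nat.le_succ e)))

/-- The pattern of congruences satisfied by a time `t` also occurs among the first `2 ^ K` terms of
the progression given by the satisfied congruences. -/
theorem exists_same_pattern {t K : ℕ} (hsel : ∀ e < K, sel e ↔ p e < L e ∧ t % L e = p e)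
    (hK : ∀ e, sel e → e < K) :
    ∃ j < 2 ^ K, ∀ e < K, p e < L e →
      ((residue sel L p K + j * modulus sel L K) % L e = p e ↔ t % L e = p e) := by
  classical
  obtain ⟨hM, ht, hdvd⟩ := residue_spec sel L p (t := t) (fun e he => (hsel e (hK e he)).1 he) K
  -- The residue classes to be avoided; an item with `L e ≤ p e` is padding and imposes nothing.
  let U := (Finset.range K).filter fun e => p e < L e ∧ t % L e ≠ p e
  have hU : ∀ e ∈ U, p e < L e ∧ t % L e ≠ p e := fun e he => (Finset.mem_filter.1 he).2
  have hΛ : 0 < ∏ e ∈ U, L e := Finset.prod_pos fun e he => by have := (hU e he).1; omega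
  -- The `x`-th term of the progression agrees with `t` modulo every modulus in `U`, so it avoids
  -- all these classes; this is the term needed to apply `exists_lt_two_pow_avoiding`.
  obtain ⟨x, y, hxy⟩ := exists_add_mul_eq hM hΛ ht
  obtain ⟨j, hj, hav⟩ := exists_lt_two_pow_avoiding U L p (fun e he => (hU e he).1)
    (residue sel L p K) (modulus sel L K) x (fun e he => by
      have h2 : t + y * (modulus sel L K * ∏ e ∈ U, L e) ≡ t [MOD L e] := by
        have : y * (modulus sel L K * ∏ e ∈ U, L e) ≡ 0 [MOD L e] := (Nat.modEq_zero_iff_dvd).2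
          (((Finset.dvd_prod_of_mem L he).mul_left _).mul_left _)
        simpa using (Nat.ModEq.refl t).add this
      rw [hxy, h2]
      exact (hU e he).2)
  have hcard : U.card ≤ K := (Finset.card_filter_le _ _).trans (Finset.card_range K).le
  refine ⟨j, hj.trans_le (Nat.pow_le_pow_right (by norm_num) hcard), fun e he hpe => ?_⟩
  by_cases hte : t % L e = p e
  · refine iff_of_true ?_ hte
    have hd := hdvd e he ((hsel e he).2 ⟨hpe, hte⟩)
    rw [← hte]
    have h1 : residue sel L p K + j * modulus sel L K ≡ residue sel L p K [MOD L e] := by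
      simpa using (Nat.ModEq.refl (residue sel L p K)).add
        ((Nat.modEq_zero_iff_dvd).2 (hd.mul_left j))
    exact h1.trans (ht.of_dvd hd).symm
  · exact iff_of_false (hav e (Finset.mem_filter.2 ⟨Finset.mem_range.2 he, hpe, hte⟩)) hte

end Periodic

/-! ### Branch sets -/

namespace SimpleGraph

variable {V W : Type} {H : SimpleGraph W} {G : SimpleGraph V}

/-- Branch sets of a minor: `R h` is the branch set of the vertex `h`. Connectedness is expressed
by cuts. -/
structure IsMinorModel (H : SimpleGraph W) (G : SimpleGraph V) (R : W → V → Prop) : Prop where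
  nonempty : ∀ h, ∃ v, R h v
  disjoint : ∀ h h' v, R h v → R h' v → h = h'
  connected : ∀ h (S : V → Prop), (∃ v, R h v ∧ S v) → (∃ v, R h v ∧ ¬ S v) →
    ∃ v v', R h v ∧ R h v' ∧ S v ∧ ¬ S v' ∧ G.Adj v v'
  adj : ∀ h h', H.Adj h h' → ∃ v v', R h v ∧ R h' v' ∧ G.Adj v v'

/-- Branch sets of the smaller graph serve for the larger one; only a contraction changes them, and
there `v` joins the branch set that contains `u`, if any. -/
theorem IsMinorOf.exists_model (h : H.IsMinorOf G) : ∃ R, IsMinorModel H G R := by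
  induction h with
  | iso h =>
    obtain ⟨φ⟩ := h
    refine ⟨fun h v => φ h = v, fun h => ⟨_, rfl⟩, fun h h' v e e' => φ.injective (e.trans e'.symm),
      ?_, fun h h' a => ⟨_, _, rfl, rfl, φ.map_adj_iff.2 a⟩⟩
    rintro h S ⟨_, rfl, hS⟩ ⟨_, rfl, hS'⟩
    exact absurd hS hS'
  | @deleteVertex V G v₀ _ ih =>
    obtain ⟨R, hR⟩ := ih
    refine ⟨fun h v => ∃ hv : v ≠ v₀, R h ⟨v, hv⟩, fun h => ?_, ?_, ?_, fun h h' a => ?_⟩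
    · obtain ⟨v, hv⟩ := hR.nonempty h
      exact ⟨v, v.2, hv⟩
    · rintro h h' v ⟨_, e⟩ ⟨_, e'⟩
      exact hR.disjoint h h' _ e e'
    · rintro h S ⟨v, ⟨hv, e⟩, hS⟩ ⟨v', ⟨hv', e'⟩, hS'⟩
      obtain ⟨x, y, hx, hy, hSx, hSy, hxy⟩ := hR.connected h (fun x => S x) ⟨_, e, hS⟩ ⟨_, e', hS'⟩
      exact ⟨x, y, ⟨x.2, hx⟩, ⟨y.2, hy⟩, hSx, hSy, hxy⟩
    · obtain ⟨x, y, hx, hy, hxy⟩ := hR.adj h h' a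
      exact ⟨x, y, ⟨x.2, hx⟩, ⟨y.2, hy⟩, hxy⟩
  | @deleteEdge V G e he _ ih =>
    obtain ⟨R, hR⟩ := ih
    refine ⟨R, hR.nonempty, hR.disjoint, fun h S h1 h2 => ?_, fun h h' a => ?_⟩
    · obtain ⟨x, y, hx, hy, hSx, hSy, hxy⟩ := hR.connected h S h1 h2
      exact ⟨x, y, hx, hy, hSx, hSy, (deleteEdges_adj.1 hxy).1⟩
    · obtain ⟨x, y, hx, hy, hxy⟩ := hR.adj h h' a
      exact ⟨x, y, hx, hy, (deleteEdges_adj.1 hxy).1⟩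
  | @contract V G u v huv _ ih =>
    obtain ⟨R, hR⟩ := ih
    let u' : {x : V // x ≠ v} := ⟨u, huv.ne⟩
    let R' : W → V → Prop := fun h x => (∃ hx : x ≠ v, R h ⟨x, hx⟩) ∨ (x = v ∧ R h u')
    have hold : ∀ {h} {x : {x : V // x ≠ v}}, R h x → R' h x := fun {h x} hx => .inl ⟨x.2, hx⟩
    have hedge : ∀ {h h'} {x y : {x : V // x ≠ v}}, R h x → R h' y → (G.contractEdge u v).Adj x y →
        ∃ a b, R' h a ∧ R' h' b ∧ (a = x ∨ (a = v ∧ (x : V) = u)) ∧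
          (b = y ∨ (b = v ∧ (y : V) = u)) ∧ G.Adj a b := by
      rintro h h' x y hx hy ⟨-, h1 | ⟨h1, h2⟩ | ⟨h1, h2⟩⟩
      · exact ⟨x, y, hold hx, hold hy, .inl rfl, .inl rfl, h1⟩
      · exact ⟨v, y, .inr ⟨rfl, by rwa [show u' = x from Subtype.ext h1.symm]⟩, hold hy,
          .inr ⟨rfl, h1⟩, .inl rfl, h2⟩
      · exact ⟨x, v, hold hx, .inr ⟨rfl, by rwa [show u' = y from Subtype.ext h1.symm]⟩,
          .inl rfl, .inr ⟨rfl, h1⟩, h2.symm⟩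
    refine ⟨R', fun h => ?_, ?_, fun h S h1 h2 => ?_, fun h h' a => ?_⟩
    · obtain ⟨x, hx⟩ := hR.nonempty h
      exact ⟨x, hold hx⟩
    · rintro h h' x (⟨hx, e⟩ | ⟨hx, e⟩) (⟨hx', e'⟩ | ⟨hx', e'⟩)
      · exact hR.disjoint h h' _ e e'
      · exact absurd hx' hx
      · exact absurd hx hx'
      · exact hR.disjoint h h' _ e e'
    -- If the cut separates `u` from `v`, the contracted edge itself crosses it. Otherwise the cut
    -- descends to the contracted graph, and a crossing edge there lifts by `hedge`.
    · by_cases hu : R h u' ∧ ¬ (S u ↔ S v)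
      · obtain ⟨hu, hS⟩ := hu
        by_cases hSu : S u
        · exact ⟨u, v, hold hu, .inr ⟨rfl, hu⟩, hSu, by tauto, huv⟩
        · exact ⟨v, u, .inr ⟨rfl, hu⟩, hold hu, by tauto, hSu, huv.symm⟩
      · have hsame : R h u' → (S u ↔ S v) := fun h' => by tauto
        have hdown : ∀ {S : V → Prop}, (R h u' → (S u ↔ S v)) → (∃ x, R' h x ∧ S x) →
            ∃ x : {x : V // x ≠ v}, R h x ∧ S x := by
          rintro S hsame ⟨x, ⟨hx, e⟩ | ⟨rfl, e⟩, hSx⟩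
          · exact ⟨_, e, hSx⟩
          · exact ⟨u', e, (hsame e).2 hSx⟩
        obtain ⟨x, y, hx, hy, hSx, hSy, hxy⟩ := hR.connected h (fun x => S x) (hdown hsame h1)
          (hdown (S := fun x => ¬ S x) (fun e => not_congr (hsame e)) h2)
        obtain ⟨a, b, ha, hb, hax, hby, hab⟩ := hedge hx hy hxy
        refine ⟨a, b, ha, hb, ?_, ?_, hab⟩
        · rcases hax with rfl | ⟨rfl, hxu⟩
          · exact hSx
          · rw [show x = u' from Subtype.ext hxu] at hx hSx
            exact (hsame hx).1 hSx
        · rcases hby with rfl | ⟨rfl, hyu⟩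
          · exact hSy
          · rw [show y = u' from Subtype.ext hyu] at hy hSy
            exact fun hv => hSy ((hsame hy).2 hv)
    · obtain ⟨x, y, hx, hy, hxy⟩ := hR.adj h h' a
      obtain ⟨a, b, ha, hb, -, -, hab⟩ := hedge hx hy hxy
      exact ⟨a, b, ha, hb, hab⟩

/-- Surplus edges are deleted one at a time, by induction on the number of edges. -/
theorem isMinorOf_of_equiv [Finite V] (φ : W ≃ V) (hφ : ∀ h h', H.Adj h h' → G.Adj (φ h) (φ h')) :
    H.IsMinorOf G := by
  induction hn : G.edgeSet.ncard using Nat.strong_induction_on generalizing G with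
  | _ n ih =>
    by_cases hiso : ∀ h h', G.Adj (φ h) (φ h') → H.Adj h h'
    · exact .iso ⟨⟨φ, fun {h h'} => ⟨hiso h h', hφ h h'⟩⟩⟩
    · push Not at hiso
      obtain ⟨h, h', hG, hH⟩ := hiso
      have he : s(φ h, φ h') ∈ G.edgeSet := hG
      refine .deleteEdge _ he (ih _ ?_ (fun a a' hadj => ?_) rfl)
      · rw [← hn, edgeSet_deleteEdges]
        exact Set.ncard_lt_ncard ⟨Set.sdiff_subset, fun hle => (hle he).2 rfl⟩ (Set.toFinite _)
      · refine deleteEdges_adj.2 ⟨hφ a a' hadj, fun hmem => hH ?_⟩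
        rcases Sym2.eq_iff.1 (Set.mem_singleton_iff.1 hmem) with ⟨h1, h2⟩ | ⟨h1, h2⟩
        · rwa [← φ.injective h1, ← φ.injective h2]
        · rw [← φ.injective h1, ← φ.injective h2]
          exact hadj.symm

/-- Induction on the number of vertices: a vertex outside all branch sets is deleted, and an edge
inside a branch set with two vertices is contracted. Once the branch sets are singletons covering
`V`, `H` is a spanning subgraph up to isomorphism. -/
theorem IsMinorModel.isMinorOf [Finite V] {R : W → V → Prop} (hR : IsMinorModel H G R) :
    H.IsMinorOf G := by
  induction hn : Nat.card V using Nat.strong_induction_on generalizing V with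
  | _ n ih =>
    have hcard : ∀ v : V, Nat.card {x : V // x ≠ v} < n := fun v => by
      rw [← hn]
      exact Finite.card_subtype_lt (x := v) (by simp)
    by_cases hcov : ∃ v, ∀ h, ¬ R h v
    · obtain ⟨v, hv⟩ := hcov
      have hne : ∀ {h x}, R h x → x ≠ v := fun {h x} hx e => hv h (e ▸ hx)
      refine .deleteVertex v (ih _ (hcard v) (V := {x : V // x ≠ v}) (R := fun h x => R h x)
        ⟨fun h => ?_, fun h h' x => hR.disjoint h h' x, fun h S h1 h2 => ?_, fun h h' a => ?_⟩ rfl)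
      · obtain ⟨x, hx⟩ := hR.nonempty h
        exact ⟨⟨x, hne hx⟩, hx⟩
      · obtain ⟨x, hx, hSx⟩ := h1
        obtain ⟨y, hy, hSy⟩ := h2
        obtain ⟨a, b, ha, hb, ⟨_, hSa⟩, hSb, hab⟩ := hR.connected h (fun x => ∃ hx : x ≠ v, S ⟨x, hx⟩)
          ⟨x, hx, x.2, hSx⟩ ⟨y, hy, fun ⟨_, h⟩ => hSy h⟩
        exact ⟨⟨a, hne ha⟩, ⟨b, hne hb⟩, ha, hb, hSa, fun h => hSb ⟨hne hb, h⟩, hab⟩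
      · obtain ⟨x, y, hx, hy, hxy⟩ := hR.adj h h' a
        exact ⟨⟨x, hne hx⟩, ⟨y, hne hy⟩, hx, hy, hxy⟩
    push Not at hcov
    by_cases hbig : ∃ h x y, R h x ∧ R h y ∧ x ≠ y
    · obtain ⟨h₀, x₀, y₀, hx₀, hy₀, hne₀⟩ := hbig
      -- The cut that isolates `x₀` provides an edge inside the branch set.
      obtain ⟨u, v, hu, hv, -, -, huv⟩ := hR.connected h₀ (· = x₀) ⟨x₀, hx₀, rfl⟩
        ⟨y₀, hy₀, hne₀.symm⟩
      let u' : {x : V // x ≠ v} := ⟨u, huv.ne⟩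
      have hvh : ∀ {h}, R h v → R h u := fun {h} e => hR.disjoint h₀ h v hv e ▸ hu
      classical
      -- The quotient map of the contraction: it preserves branch sets and maps edges to edges
      -- unless their ends are identified.
      let π : V → {x : V // x ≠ v} := fun x => if hx : x = v then u' else ⟨x, hx⟩
      have hπv : π v = u' := dif_pos rfl
      have hπ : ∀ {x} (hx : x ≠ v), π x = ⟨x, hx⟩ := fun {x} hx => dif_neg hx
      have hπR : ∀ {h x}, R h x → R h (π x) := by
        intro h x hx
        by_cases hxv : x = v
        · subst hxv
          rw [hπv]
          exact hvh hx
        · rwa [hπ hxv]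
      have hπadj : ∀ {x y}, G.Adj x y → π x ≠ π y → (G.contractEdge u v).Adj (π x) (π y) := by
        intro x y hxy hne
        refine ⟨hne, ?_⟩
        by_cases hxv : x = v
        · subst hxv
          rw [hπv, hπ hxy.ne.symm]
          exact .inr (.inl ⟨rfl, hxy⟩)
        · by_cases hyv : y = v
          · subst hyv
            rw [hπv, hπ hxv]
            exact .inr (.inr ⟨rfl, hxy.symm⟩)
          · rw [hπ hxv, hπ hyv]
            exact .inl hxy
      refine .contract u v huv (ih _ (hcard v) (V := {x : V // x ≠ v}) (R := fun h x => R h x)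
        ⟨fun h => ?_, fun h h' x => hR.disjoint h h' x, fun h S h1 h2 => ?_, fun h h' a => ?_⟩ rfl)
      · obtain ⟨x, hx⟩ := hR.nonempty h
        exact ⟨π x, hπR hx⟩
      · obtain ⟨x, hx, hSx⟩ := h1
        obtain ⟨y, hy, hSy⟩ := h2
        obtain ⟨a, b, ha, hb, hSa, hSb, hab⟩ := hR.connected h (fun x => S (π x))
          ⟨x, hx, by rwa [hπ x.2]⟩ ⟨y, hy, by rwa [hπ y.2]⟩
        exact ⟨π a, π b, hπR ha, hπR hb, hSa, hSb, hπadj hab fun e => hSb (e ▸ hSa)⟩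
      · obtain ⟨x, y, hx, hy, hxy⟩ := hR.adj h h' a
        refine ⟨π x, π y, hπR hx, hπR hy, hπadj hxy fun e => a.ne ?_⟩
        exact hR.disjoint h h' (π x) (hπR hx) (e ▸ hπR hy)
    · push Not at hbig
      choose φ hφ using hR.nonempty
      have hbij : Function.Bijective φ := by
        refine ⟨fun h h' e => hR.disjoint h h' (φ h) (hφ h) (e ▸ hφ h'), fun v => ?_⟩
        obtain ⟨h, hh⟩ := hcov v
        exact ⟨h, hbig h _ _ (hφ h) hh⟩
      refine isMinorOf_of_equiv (Equiv.ofBijective φ hbij) fun h h' a => ?_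
      obtain ⟨x, y, hx, hy, hxy⟩ := hR.adj h h' a
      simpa [hbig h _ _ (hφ h) hx, hbig h' _ _ (hφ h') hy] using hxy

theorem isMinorOf_iff_exists_model [Finite V] : H.IsMinorOf G ↔ ∃ R, IsMinorModel H G R :=
  ⟨IsMinorOf.exists_model, fun ⟨_, hR⟩ => hR.isMinorOf⟩

end SimpleGraph

/-! ### Decoding an instance -/

/-- The position of the `k`-th element of `A`, or `n` if there is no such element below `n`. -/
def nthPos (A : ℕ → Prop) [DecidablePred A] (n k : ℕ) : ℕ :=
  Nat.count (fun i => Nat.count A (i + 1) ≤ k) n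

theorem nthPos_le (A : ℕ → Prop) [DecidablePred A] (n k : ℕ) : nthPos A n k ≤ n := Nat.count_le _

theorem nthPos_count {A : ℕ → Prop} [DecidablePred A] {n i : ℕ} (hi : i < n) (hA : A i) :
    nthPos A n (Nat.count A i) = i := by
  have h : ∀ j, Nat.count A (j + 1) ≤ Nat.count A i ↔ j < i := fun j => by
    refine ⟨fun hj => ?_, fun hj => Nat.count_monotone A hj⟩
    by_contra hlt
    have := Nat.count_monotone A (show i + 1 ≤ j + 1 by omega)
    rw [Nat.count_succ, if_pos hA] at this
    omega
  simp only [nthPos, h]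
  exact RAM.Comp.count_lt_eq hi.le

theorem count_congr_lt {A B : ℕ → Prop} [DecidablePred A] [DecidablePred B] {n : ℕ}
    (h : ∀ i < n, (A i ↔ B i)) : Nat.count A n = Nat.count B n := by
  rw [Nat.count_eq_card_filter_range, Nat.count_eq_card_filter_range]
  congr 1
  exact Finset.filter_congr fun i hi => h i (Finset.mem_range.1 hi)

/-! ### Words separated by the letter `2`. -/

namespace RAM

theorem letterAt_append_right (A B : List (Fin 3)) (i : ℕ) :
    letterAt (A ++ B) (A.length + i) = letterAt B i := by
  simp [letterAt, List.getElem?_append_right]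

theorem letterAt_append_left {A B : List (Fin 3)} {i : ℕ} (h : i < A.length) :
    letterAt (A ++ B) i = letterAt A i := by
  simp [letterAt, List.getElem?_append_left h]

theorem letterAt_of_lt {A : List (Fin 3)} {i : ℕ} (h : i < A.length) : letterAt A i = A[i].val := by
  simp [letterAt, List.getElem?_eq_getElem h]

theorem count_letterAt (A : List (Fin 3)) (c : Fin 3) :
    Nat.count (fun i => letterAt A i = c.val) A.length = A.count c := by
  induction A using List.reverseRecOn with
  | nil => simp
  | append_singleton A a ih =>
    rw [List.length_append, List.length_singleton, Nat.count_succ, List.count_append,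
      count_congr_lt (B := fun i => letterAt A i = c.val)
        (fun i hi => by rw [letterAt_append_left hi]), ih]
    have : letterAt (A ++ [a]) A.length = a.val := by
      simp [letterAt]
    rw [this]
    simp [Fin.ext_iff, List.count_singleton]

/-- The concatenation of words, each terminated by the letter `2`. -/
def joinWords (ws : List (List (Fin 3))) : List (Fin 3) := ws.flatMap (· ++ [2])

theorem joinWords_append (ws ws' : List (List (Fin 3))) :
    joinWords (ws ++ ws') = joinWords ws ++ joinWords ws' := List.flatMap_append

theorem joinWords_cons (w : List (Fin 3)) (ws : List (List (Fin 3))) :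
    joinWords (w :: ws) = w ++ 2 :: joinWords ws := by
  simp [joinWords]

theorem count_joinWords {ws : List (List (Fin 3))} (h : ∀ w ∈ ws, 2 ∉ w) :
    (joinWords ws).count 2 = ws.length := by
  induction ws with
  | nil => simp [joinWords]
  | cons w ws ih =>
    rw [joinWords_cons, List.count_append, List.count_cons_self,
      ih fun w hw => h w (List.mem_cons_of_mem _ hw),
      List.count_eq_zero_of_not_mem (h w List.mem_cons_self)]
    simp

/-- The position of the `k`-th separator `2`. -/
def sepPos (E : List (Fin 3)) (k : ℕ) : ℕ := nthPos (fun i => letterAt E i = 2) E.length k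

theorem sepPos_append {A B : List (Fin 3)} : sepPos (A ++ 2 :: B) (A.count 2) = A.length := by
  have h1 : Nat.count (fun i => letterAt (A ++ 2 :: B) i = 2) A.length = A.count 2 := by
    rw [← count_letterAt A 2]
    exact count_congr_lt fun i hi => by rw [letterAt_append_left hi]; rfl
  rw [← h1]
  refine nthPos_count (by simp) ?_
  have := letterAt_append_right A (2 :: B) 0
  rw [Nat.add_zero] at this
  rw [this]
  rfl

variable {ws : List (List (Fin 3))} {w rest : List (Fin 3)} {k : ℕ}

theorem joinWords_split (hk : ws[k]? = some w) (rest : List (Fin 3)) :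
    joinWords ws ++ rest = (joinWords (ws.take k) ++ w) ++ 2 :: (joinWords (ws.drop (k + 1)) ++ rest) := by
  obtain ⟨hlt, rfl⟩ := List.getElem?_eq_some_iff.1 hk
  conv_lhs => rw [← List.take_append_drop k ws, List.drop_eq_getElem_cons hlt]
  rw [joinWords_append, joinWords_cons]
  simp

theorem sepPos_joinWords (h : ∀ w ∈ ws, 2 ∉ w) (hk : ws[k]? = some w) (rest : List (Fin 3)) :
    sepPos (joinWords ws ++ rest) k = (joinWords (ws.take k)).length + w.length := by
  have hlt := (List.getElem?_eq_some_iff.1 hk).1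
  have hcount : (joinWords (ws.take k) ++ w).count 2 = k := by
    rw [List.count_append, count_joinWords fun w hw => h w (List.mem_of_mem_take hw),
      List.count_eq_zero_of_not_mem (h w (List.mem_of_getElem? hk)), List.length_take]
    omega
  have := sepPos_append (A := joinWords (ws.take k) ++ w) (B := joinWords (ws.drop (k + 1)) ++ rest)
  rwa [hcount, ← joinWords_split hk, List.length_append] at this

theorem length_joinWords_take_succ (hk : ws[k]? = some w) :
    (joinWords (ws.take (k + 1))).length = (joinWords (ws.take k)).length + w.length + 1 := by
  rw [List.take_add_one, hk, Option.toList_some, joinWords_append, joinWords_cons]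
  simp [joinWords, add_assoc]

theorem letterAt_joinWords (hk : ws[k]? = some w) (rest : List (Fin 3)) {i : ℕ} (hi : i < w.length) :
    letterAt (joinWords ws ++ rest) ((joinWords (ws.take k)).length + i) = letterAt w i := by
  rw [joinWords_split hk, List.append_assoc, letterAt_append_right, letterAt_append_left hi]

end RAM

open RAM

theorem flatMap_finRange_eq_ofFn {β : Type} {n : ℕ} (f : Fin n → Fin n → β) :
    ((List.finRange n).flatMap fun u => (List.finRange n).map fun v => f u v) =
      List.ofFn fun q : Fin (n * n) => f q.divNat q.modNat := by
  rw [List.ofFn_mul, List.ofFn_eq_map, List.flatMap_def]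
  congr 1
  refine List.map_congr_left fun u _ => ?_
  rw [List.ofFn_eq_map]
  refine List.map_congr_left fun v _ => ?_
  congr 1
  · refine Fin.ext ?_
    have hn : 0 < n := u.pos
    simp [Fin.divNat, Nat.add_comm,
      Nat.add_mul_div_right _ _ hn, Nat.div_eq_of_lt v.2]
  · refine Fin.ext ?_
    simp [Fin.modNat, Nat.add_mod, Nat.mod_eq_of_lt v.2]

theorem getElem?_ofFn_mul {β : Type} {n : ℕ} (f : Fin n → Fin n → β) (u v : Fin n) :
    (List.ofFn fun q : Fin (n * n) => f q.divNat q.modNat)[(u : ℕ) * n + v]? = some (f u v) := by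
  have hn : 0 < n := u.pos
  have hlt : (u : ℕ) * n + v < n * n := by nlinarith [u.2, v.2]
  rw [List.getElem?_eq_getElem (by simpa using hlt), List.getElem_ofFn]
  congr 2
  · refine Fin.ext ?_
    simp [Fin.divNat, Nat.add_comm, Nat.add_mul_div_right _ _ hn, Nat.div_eq_of_lt v.2]
  · refine Fin.ext ?_
    simp [Fin.modNat, Nat.add_mod, Nat.mod_eq_of_lt v.2]

namespace EPGInstance

variable (x : EPGInstance)

/-- The words in the encoding that are terminated by `2`. -/
noncomputable def words : List (List (Fin 3)) :=
  List.replicate x.n 1 :: (List.ofFn fun q : Fin (x.n * x.n) => x.𝒢.labelWord q.divNat q.modNat) ++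
    [List.replicate x.m 1]

open Classical in
/-- The adjacency matrix of `H`, row by row. -/
noncomputable def matrix : List (Fin 3) :=
  List.ofFn fun q : Fin (x.m * x.m) => if x.H.Adj q.divNat q.modNat then 1 else 0

theorem encode_eq : x.encode = joinWords x.words ++ x.matrix := by
  classical
  rw [encode, EPG.encode, SimpleGraph.encode, words, joinWords_append, matrix,
    ← flatMap_finRange_eq_ofFn,
    ← flatMap_finRange_eq_ofFn (fun u v => if x.H.Adj u v then (1 : Fin 3) else 0)]
  simp [joinWords, List.flatMap_assoc, List.flatMap_map]

theorem two_notMem_labelWord (u v : Fin x.n) : 2 ∉ x.𝒢.labelWord u v := by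
  rw [EPG.labelWord]
  split_ifs
  · simp only [List.mem_map, not_exists, not_and]
    rintro (_ | _) _ <;> decide
  · simp

theorem two_notMem_words : ∀ w ∈ x.words, 2 ∉ w := by
  intro w hw
  simp only [words, List.cons_append, List.mem_cons, List.mem_append, List.not_mem_nil, or_false] at hw
  rcases hw with rfl | hw | rfl
  · simp [List.mem_replicate]
  · obtain ⟨q, rfl⟩ := (List.mem_ofFn' _ _).1 hw
    exact x.two_notMem_labelWord _ _
  · simp [List.mem_replicate]

/-- The letter at a position of the encoding. -/
noncomputable def letter (i : ℕ) : ℕ := letterAt x.encode i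

/-- The position of the `k`-th separator in the encoding. -/
noncomputable def sep (k : ℕ) : ℕ := sepPos x.encode k

/-- The length of the `q`-th label word. -/
noncomputable def wordLen (q : ℕ) : ℕ := x.sep (q + 1) - (x.sep q + 1)

/-- The letter at position `i` of the `q`-th label word. -/
noncomputable def wordLetter (q i : ℕ) : ℕ := x.letter (x.sep q + 1 + i)

theorem sep_le (k : ℕ) : x.sep k ≤ x.encode.length := nthPos_le _ _ _

theorem wordLen_le (q : ℕ) : x.wordLen q ≤ x.encode.length := (Nat.sub_le _ _).trans (x.sep_le _)

variable {x}

theorem sep_eq {k : ℕ} {w : List (Fin 3)} (hk : x.words[k]? = some w) :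
    x.sep k = (joinWords (x.words.take k)).length + w.length := by
  rw [sep, encode_eq, sepPos_joinWords x.two_notMem_words hk]

theorem sep_add_one {k : ℕ} {w : List (Fin 3)} (hk : x.words[k]? = some w) :
    x.sep k + 1 = (joinWords (x.words.take (k + 1))).length := by
  rw [sep_eq hk, length_joinWords_take_succ hk]

theorem exists_word {k : ℕ} (hk : k < x.n * x.n + 2) : ∃ w, x.words[k]? = some w :=
  ⟨_, List.getElem?_eq_getElem (by simp [words]; omega)⟩

/-- Word `0` is `1ⁿ`, so the `q`-th label is word `q + 1` and lies between the separators `q` and `q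
+ 1`. -/
theorem wordLen_eq {q : ℕ} {w : List (Fin 3)} (hk : x.words[q + 1]? = some w) :
    x.wordLen q = w.length := by
  obtain ⟨w', hw'⟩ := exists_word (x := x) (k := q) (by
    have := (List.getElem?_eq_some_iff.1 hk).1
    simp [words] at this
    omega)
  rw [wordLen, sep_add_one hw', sep_eq hk]
  omega

theorem wordLetter_eq {q i : ℕ} {w : List (Fin 3)} (hk : x.words[q + 1]? = some w)
    (hi : i < w.length) : x.wordLetter q i = letterAt w i := by
  obtain ⟨w', hw'⟩ := exists_word (x := x) (k := q) (by
    have := (List.getElem?_eq_some_iff.1 hk).1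
    simp [words] at this
    omega)
  rw [wordLetter, letter, encode_eq, sep_add_one hw', letterAt_joinWords hk _ hi]

theorem words_label (u v : Fin x.n) :
    x.words[(u : ℕ) * x.n + v + 1]? = some (x.𝒢.labelWord u v) := by
  have hlt : (u : ℕ) * x.n + v < x.n * x.n := by nlinarith [u.2, v.2]
  rw [words, List.cons_append, List.getElem?_cons_succ, List.getElem?_append_left (by simpa using hlt)]
  exact getElem?_ofFn_mul (fun u v => x.𝒢.labelWord u v) u v

theorem words_last : x.words[x.n * x.n + 1]? = some (List.replicate x.m 1) := by
  simp [words]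

variable (x)

theorem sep_zero : x.sep 0 = x.n := by
  rw [sep_eq (w := List.replicate x.n 1) rfl]
  simp [joinWords]

theorem wordLen_last : x.wordLen (x.n * x.n) = x.m := by
  rw [wordLen_eq words_last, List.length_replicate]

theorem m_le_length : x.m ≤ x.encode.length := x.wordLen_last ▸ x.wordLen_le _

theorem n_le_param : x.n ≤ x.param := Nat.le_add_right _ _

/-- Adjacency in `H`, as read off the encoding. -/
def hAdj (h h' : ℕ) : Prop := x.letter (x.sep (x.n * x.n + 1) + 1 + (h * x.m + h')) = 1

theorem hAdj_iff (h h' : Fin x.m) : x.hAdj h h' ↔ x.H.Adj h h' := by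
  classical
  have hlen : x.words.take (x.n * x.n + 1 + 1) = x.words := List.take_of_length_le (by simp [words])
  rw [hAdj, letter, encode_eq, sep_add_one words_last, hlen, letterAt_append_right, letterAt, matrix]
  have := getElem?_ofFn_mul (fun u v => if x.H.Adj u v then (1 : Fin 3) else 0) h h'
  rw [this]
  by_cases hA : x.H.Adj h h' <;> simp [hA]

/-- Adjacency at time `t`, as read off the encoding. -/
def adjAt (t u v : ℕ) : Prop :=
  x.wordLen (u * x.n + v) ≠ 0 ∧
    x.wordLetter (u * x.n + v) (t % x.wordLen (u * x.n + v)) = 1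

/-- Non-edges are encoded by the empty word, whereas labels of edges contain a `1` and are nonempty;
the length thus tells them apart. -/
theorem adjAt_iff (t : ℕ) (u v : Fin x.n) : x.adjAt t u v ↔ (x.𝒢.snapshot t).Adj u v := by
  rw [adjAt, wordLen_eq (words_label u v)]
  by_cases h : s(u, v) ∈ x.𝒢.graph.edgeSet
  · have hw : x.𝒢.labelWord u v = (x.𝒢.label ⟨s(u, v), h⟩).map fun b => if b then 1 else 0 := by
      rw [EPG.labelWord, dif_pos h]
    have hlen : (x.𝒢.labelWord u v).length = (x.𝒢.label ⟨s(u, v), h⟩).length := by simp [hw]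
    have hpos : 0 < (x.𝒢.label ⟨s(u, v), h⟩).length := List.length_pos_of_mem (x.𝒢.one_mem _)
    have hmod := Nat.mod_lt t hpos
    rw [hlen, wordLetter_eq (words_label u v) (by rw [hlen]; exact hmod),
      letterAt_of_lt (by rw [hlen]; exact hmod)]
    have hsn : (x.𝒢.snapshot t).Adj u v ↔ periodicLetter (x.𝒢.label ⟨s(u, v), h⟩) t = true :=
      ⟨fun ⟨_, h⟩ => h, fun h' => ⟨h, h'⟩⟩
    rw [hsn, periodicLetter, List.getD_eq_getElem _ _ hmod]
    simp only [hw, List.getElem_map]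
    cases (x.𝒢.label ⟨s(u, v), h⟩)[t % (x.𝒢.label ⟨s(u, v), h⟩).length] <;> simp [hpos.ne']
  · have hw : x.𝒢.labelWord u v = [] := by rw [EPG.labelWord, dif_neg h]
    refine iff_of_false (by simp [hw]) fun ⟨hmem, _⟩ => h hmem

/-! ### The congruences that determine a snapshot, and the candidate times. -/

/-- The number of occurrences of the letter `b` in the `q`-th label word. -/
noncomputable def letterCount (b q : ℕ) : ℕ :=
  Nat.count (fun i => x.wordLetter q i = b) (x.wordLen q)

/-- The maximal number of occurrences of the letter `b` in a label word. -/
noncomputable def maxCount (b : ℕ) : ℕ := (Finset.range (x.n * x.n)).sup (x.letterCount b)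

/-- The maximal number of occurrences of the less frequent letter in a label word. -/
noncomputable def minorCount : ℕ := min (x.maxCount 0) (x.maxCount 1)

/-- The less frequent letter. -/
noncomputable def minorLetter : ℕ := if x.maxCount 0 ≤ x.maxCount 1 then 0 else 1

theorem exists_fin_of_lt {n q : ℕ} (hq : q < n * n) : ∃ u v : Fin n, q = (u : ℕ) * n + v := by
  have hn : 0 < n := Nat.pos_of_ne_zero fun h => by simp [h] at hq
  refine ⟨⟨q / n, Nat.div_lt_of_lt_mul hq⟩, ⟨q % n, Nat.mod_lt q hn⟩, ?_⟩
  simp [Nat.div_add_mod']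

theorem letterCount_eq (c : Fin 3) (u v : Fin x.n) :
    x.letterCount c ((u : ℕ) * x.n + v) = (x.𝒢.labelWord u v).count c := by
  rw [letterCount, wordLen_eq (words_label u v), ← count_letterAt]
  exact count_congr_lt fun i hi => by rw [wordLetter_eq (words_label u v) hi]

theorem maxCount_le (c : Fin 3) (d : Bool) (hcd : (if d then (1 : Fin 3) else 0) = c) :
    x.maxCount c ≤ ⨆ e, (x.𝒢.label e).count d := by
  refine Finset.sup_le fun q hq => ?_
  obtain ⟨u, v, rfl⟩ := exists_fin_of_lt (Finset.mem_range.1 hq)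
  rw [letterCount_eq, EPG.labelWord]
  split_ifs with h
  · subst hcd
    rw [List.count_map_of_injective _ (fun b : Bool => if b then (1 : Fin 3) else 0) (by decide)]
    exact le_ciSup (f := fun e => (x.𝒢.label e).count d) (Set.finite_range _).bddAbove ⟨s(u, v), h⟩
  · simp

theorem minorCount_le_param : x.minorCount ≤ x.param := by
  have h0 : x.maxCount 0 ≤ x.𝒢.maxZeros := x.maxCount_le 0 false rfl
  have h1 : x.maxCount 1 ≤ x.𝒢.maxOnes := x.maxCount_le 1 true rfl
  rw [minorCount, param]
  omega

theorem letterCount_minorLetter_le {q : ℕ} (hq : q < x.n * x.n) :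
    x.letterCount x.minorLetter q ≤ x.minorCount := by
  have h : ∀ b, x.letterCount b q ≤ x.maxCount b := fun b =>
    Finset.le_sup (f := x.letterCount b) (Finset.mem_range.2 hq)
  rw [minorLetter, minorCount]
  split_ifs with h'
  · rw [min_eq_left h']
    exact h 0
  · rw [min_eq_right (not_le.1 h').le]
    exact h 1

/-- The number of congruences that determine a snapshot. -/
noncomputable def itemCount : ℕ := x.n * x.n * (x.minorCount + 1)

/-- The modulus of the `e`-th congruence. -/
noncomputable def itemLen (e : ℕ) : ℕ := x.wordLen (e / (x.minorCount + 1))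

/-- The remainder in the `e`-th congruence: the position of an occurrence of the less frequent
letter in a label word. -/
noncomputable def itemPos (e : ℕ) : ℕ :=
  nthPos (fun i => x.wordLetter (e / (x.minorCount + 1)) i = x.minorLetter)
    (x.wordLen (e / (x.minorCount + 1))) (e % (x.minorCount + 1))

/-- The `e`-th congruence is selected by the bit mask `c`. -/
def Selected (c e : ℕ) : Prop := c.testBit e = true ∧ x.itemPos e < x.itemLen e

noncomputable instance (c : ℕ) : DecidablePred (x.Selected c) := fun _ => instDecidableAnd

/-- The `j`-th candidate time for the bit mask `c`. -/
noncomputable def timeAt (c j : ℕ) : ℕ :=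
  Periodic.residue (x.Selected c) x.itemLen x.itemPos x.itemCount +
    j * Periodic.modulus (x.Selected c) x.itemLen x.itemCount

/-- If the label shows the less frequent letter at time `t`, the position shown is its occurrence
number `Nat.count A i`, so `t` satisfies the item with that number in the block of label `q`. By
hypothesis `t'` satisfies it too, and reads the same position. -/
theorem wordLetter_minor_of_pattern {t t' q : ℕ} (hq : q < x.n * x.n) (hL : 0 < x.wordLen q)
    (h : ∀ e < x.itemCount, x.itemPos e < x.itemLen e → t % x.itemLen e = x.itemPos e →
      t' % x.itemLen e = x.itemPos e)
    (ht : x.wordLetter q (t % x.wordLen q) = x.minorLetter) :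
    x.wordLetter q (t' % x.wordLen q) = x.minorLetter := by
  set i := t % x.wordLen q with hi
  have hil : i < x.wordLen q := Nat.mod_lt t hL
  let A : ℕ → Prop := fun i => x.wordLetter q i = x.minorLetter
  let hAd : DecidablePred A := fun i => inferInstanceAs (Decidable (x.wordLetter q i = x.minorLetter))
  have hidx : Nat.count A i < x.minorCount + 1 :=
    Nat.lt_succ_of_le ((Nat.count_monotone A hil.le).trans (x.letterCount_minorLetter_le hq))
  set e := q * (x.minorCount + 1) + Nat.count A i with he
  have hdiv : e / (x.minorCount + 1) = q := by
    rw [he, Nat.add_comm, Nat.add_mul_div_right _ _ (Nat.succ_pos _), Nat.div_eq_of_lt hidx, zero_add]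
  have hmod : e % (x.minorCount + 1) = Nat.count A i := by
    rw [he, Nat.add_comm, Nat.add_mul_mod_self_right, Nat.mod_eq_of_lt hidx]
  have hlen : x.itemLen e = x.wordLen q := by rw [itemLen, hdiv]
  have hpos : x.itemPos e = i := by
    rw [itemPos, hmod]
    simp only [hdiv]
    exact nthPos_count hil ht
  have hlt : e < x.itemCount := by
    rw [itemCount]
    calc e < q * (x.minorCount + 1) + (x.minorCount + 1) := by omega
      _ = (q + 1) * (x.minorCount + 1) := by ring
      _ ≤ _ := Nat.mul_le_mul_right _ hq
  have := h e hlt (by rw [hpos, hlen]; exact hil) (by rw [hpos, hlen])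
  rw [hlen, hpos] at this
  rw [this]
  exact ht

theorem wordLetter_lt_two {q i : ℕ} (hq : q < x.n * x.n) (hi : i < x.wordLen q) :
    x.wordLetter q i = 0 ∨ x.wordLetter q i = 1 := by
  obtain ⟨u, v, rfl⟩ := exists_fin_of_lt hq
  rw [wordLen_eq (words_label u v)] at hi
  rw [wordLetter_eq (words_label u v) hi, letterAt_of_lt hi]
  have hne : (x.𝒢.labelWord u v)[i] ≠ 2 := fun h =>
    x.two_notMem_labelWord u v (h ▸ List.getElem_mem hi)
  generalize (x.𝒢.labelWord u v)[i] = c at hne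
  fin_cases c <;> simp_all

/-- Every snapshot occurs at a candidate time. -/
theorem exists_snapshot_timeAt (t : ℕ) : ∃ c < 2 ^ x.itemCount, ∃ j < 2 ^ x.itemCount,
    x.𝒢.snapshot (x.timeAt c j) = x.𝒢.snapshot t := by
  -- The mask records the congruences satisfied by `t`. Bits set at padding items, where `itemPos`
  -- equals `itemLen`, are discarded by `Selected`.
  let c := Nat.ofBits fun e : Fin x.itemCount => decide (t % x.itemLen e = x.itemPos e)
  have hc : c < 2 ^ x.itemCount := Nat.ofBits_lt_two_pow _
  obtain ⟨j, hj, hpat⟩ := Periodic.exists_same_pattern (x.Selected c) (L := x.itemLen)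
    (p := x.itemPos) (t := t) (K := x.itemCount)
    (fun e he => by
      rw [Selected, Nat.testBit_ofBits_lt _ _ he, decide_eq_true_eq]
      exact and_comm)
    (fun e he => by
      by_contra hlt
      have := Nat.testBit_lt_two_pow (hc.trans_le (Nat.pow_le_pow_right (by norm_num) (not_lt.1 hlt)))
      rw [he.1] at this
      exact Bool.noConfusion this)
  refine ⟨c, hc, j, hj, ?_⟩
  change ∀ e < x.itemCount, x.itemPos e < x.itemLen e →
    (x.timeAt c j % x.itemLen e = x.itemPos e ↔ t % x.itemLen e = x.itemPos e) at hpat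
  ext u v
  rw [← adjAt_iff, ← adjAt_iff, adjAt, adjAt]
  have hq : (u : ℕ) * x.n + v < x.n * x.n := by nlinarith [u.2, v.2]
  generalize (u : ℕ) * x.n + v = q at hq
  refine and_congr_right fun hL => ?_
  have hL := Nat.pos_of_ne_zero hL
  -- Both times show the less frequent letter on the same labels; as there are only two letters,
  -- they agree everywhere.
  have h1 := x.wordLetter_minor_of_pattern hq hL fun e he hp => (hpat e he hp).1
  have h2 := x.wordLetter_minor_of_pattern hq hL fun e he hp => (hpat e he hp).2
  have h3 := x.wordLetter_lt_two hq (Nat.mod_lt (x.timeAt c j) hL)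
  have h4 := x.wordLetter_lt_two hq (Nat.mod_lt t hL)
  have h5 : x.minorLetter = 0 ∨ x.minorLetter = 1 := by
    rw [minorLetter]
    split_ifs <;> simp
  omega

end EPGInstance

/-! ### Testing a snapshot -/

namespace EPGInstance

theorem exists_mask (n : ℕ) (S : ℕ → Prop) : ∃ c < 2 ^ n, ∀ i < n, (c.testBit i = true ↔ S i) := by
  classical
  exact ⟨Nat.ofBits fun i : Fin n => decide (S i), Nat.ofBits_lt_two_pow _, fun i hi => by
    rw [Nat.testBit_ofBits_lt _ _ hi, decide_eq_true_eq]⟩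

/-- Since `v < n`, the index `h * n + v` determines `h` and `v`; since `m ≤ n`, it stays below `n *
n`. -/
theorem exists_mask_rel {m n : ℕ} (hmn : m ≤ n) (R : Fin m → Fin n → Prop) :
    ∃ c < 2 ^ (n * n), ∀ (h : Fin m) (v : Fin n), (c.testBit (h * n + v) = true ↔ R h v) := by
  obtain ⟨c, hc, hcS⟩ := exists_mask (n * n) fun q =>
    ∃ (h : Fin m) (v : Fin n), q = (h : ℕ) * n + v ∧ R h v
  refine ⟨c, hc, fun h v => ?_⟩
  have hlt : (h : ℕ) * n + v < n * n := by nlinarith [h.2, v.2]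
  rw [hcS _ hlt]
  refine ⟨?_, fun hR => ⟨h, v, rfl, hR⟩⟩
  rintro ⟨h', v', he, hR⟩
  have hn : 0 < n := v.pos
  have h1 : (h : ℕ) = h' := by
    have := congrArg (· / n) he
    simpa [Nat.add_comm, Nat.add_mul_div_right _ _ hn, Nat.div_eq_of_lt v.2,
      Nat.div_eq_of_lt v'.2] using this
  have h2 : (v : ℕ) = v' := by rw [h1] at he; omega
  rwa [Fin.ext h1, Fin.ext h2]

variable (x : EPGInstance)

/-- `H` is an induced subgraph of the snapshot at time `t`, as witnessed by a bit matrix. -/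
def InducedAt (t : ℕ) : Prop :=
  x.m ≤ x.n ∧ ∃ c < 2 ^ (x.n * x.n),
    (∀ h < x.m, ∃ v < x.n, c.testBit (h * x.n + v) = true) ∧
    (∀ h < x.m, ∀ h' < x.m, ∀ v < x.n, c.testBit (h * x.n + v) = true →
      c.testBit (h' * x.n + v) = true → h = h') ∧
    ∀ h < x.m, ∀ h' < x.m, ∀ v < x.n, ∀ v' < x.n, c.testBit (h * x.n + v) = true →
      c.testBit (h' * x.n + v') = true → (x.hAdj h h' ↔ x.adjAt t v v')

theorem inducedAt_iff (t : ℕ) : x.InducedAt t ↔ x.H.IsIndContained (x.𝒢.snapshot t) := by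
  constructor
  · rintro ⟨-, c, -, h1, h2, h3⟩
    have h1' : ∀ h : Fin x.m, ∃ v : Fin x.n, c.testBit (h * x.n + v) = true := fun h =>
      let ⟨v, hv, hb⟩ := h1 h h.2
      ⟨⟨v, hv⟩, hb⟩
    choose φ hφ using h1'
    refine ⟨⟨⟨φ, fun h h' e => Fin.ext (h2 h h.2 h' h'.2 (φ h) (φ h).2 (hφ h) ?_)⟩, fun {h h'} => ?_⟩⟩
    · rw [e]
      exact hφ h'
    · change (x.𝒢.snapshot t).Adj (φ h) (φ h') ↔ x.H.Adj h h'
      rw [← adjAt_iff, ← hAdj_iff]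
      exact (h3 h h.2 h' h'.2 _ (φ h).2 _ (φ h').2 (hφ h) (hφ h')).symm
  · rintro ⟨φ⟩
    have hmn : x.m ≤ x.n := by simpa using Fintype.card_le_of_injective φ φ.injective
    obtain ⟨c, hc, hcR⟩ := exists_mask_rel hmn fun h v => φ h = v
    refine ⟨hmn, c, hc, fun h hh => ⟨φ ⟨h, hh⟩, (φ _).2, (hcR ⟨h, hh⟩ _).2 rfl⟩,
      fun h hh h' hh' v hv e e' => ?_, fun h hh h' hh' v hv v' hv' e e' => ?_⟩
    · have e := (hcR ⟨h, hh⟩ ⟨v, hv⟩).1 e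
      have e' := (hcR ⟨h', hh'⟩ ⟨v, hv⟩).1 e'
      exact congrArg Fin.val (φ.injective (e.trans e'.symm))
    · have e := (hcR ⟨h, hh⟩ ⟨v, hv⟩).1 e
      have e' := (hcR ⟨h', hh'⟩ ⟨v', hv'⟩).1 e'
      rw [x.hAdj_iff ⟨h, hh⟩ ⟨h', hh'⟩, x.adjAt_iff t ⟨v, hv⟩ ⟨v', hv'⟩, ← e, ← e']
      exact φ.map_adj_iff.symm

/-- `H` is a minor of the snapshot at time `t`, as witnessed by a bit matrix of branch sets. -/
def MinorAt (t : ℕ) : Prop :=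
  x.m ≤ x.n ∧ ∃ c < 2 ^ (x.n * x.n),
    (∀ h < x.m, ∃ v < x.n, c.testBit (h * x.n + v) = true) ∧
    (∀ h < x.m, ∀ h' < x.m, ∀ v < x.n, c.testBit (h * x.n + v) = true →
      c.testBit (h' * x.n + v) = true → h = h') ∧
    (∀ h < x.m, ∀ S < 2 ^ x.n, (∃ v < x.n, c.testBit (h * x.n + v) = true ∧ S.testBit v = true) →
      (∃ v < x.n, c.testBit (h * x.n + v) = true ∧ ¬ S.testBit v = true) →
      ∃ v < x.n, ∃ v' < x.n, c.testBit (h * x.n + v) = true ∧ c.testBit (h * x.n + v') = true ∧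
        S.testBit v = true ∧ ¬ S.testBit v' = true ∧ x.adjAt t v v') ∧
    ∀ h < x.m, ∀ h' < x.m, x.hAdj h h' → ∃ v < x.n, ∃ v' < x.n,
      c.testBit (h * x.n + v) = true ∧ c.testBit (h' * x.n + v') = true ∧ x.adjAt t v v'

theorem minorAt_iff (t : ℕ) : x.MinorAt t ↔ x.H.IsMinorOf (x.𝒢.snapshot t) := by
  rw [SimpleGraph.isMinorOf_iff_exists_model]
  constructor
  · rintro ⟨-, c, -, h1, h2, h3, h4⟩
    refine ⟨fun h v => c.testBit (h * x.n + v) = true, fun h => ?_,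
      fun h h' v e e' => Fin.ext (h2 h h.2 h' h'.2 v v.2 e e'), fun h S hS hS' => ?_, fun h h' a => ?_⟩
    · obtain ⟨v, hv, hb⟩ := h1 h h.2
      exact ⟨⟨v, hv⟩, hb⟩
    · obtain ⟨s, hs, hsS⟩ := exists_mask x.n fun i => ∃ hi : i < x.n, S ⟨i, hi⟩
      have hsS' : ∀ v : Fin x.n, (s.testBit v = true ↔ S v) := fun v =>
        (hsS v v.2).trans ⟨fun ⟨_, h⟩ => h, fun h => ⟨v.2, h⟩⟩
      obtain ⟨a, ha, hSa⟩ := hS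
      obtain ⟨b, hb, hSb⟩ := hS'
      obtain ⟨v, hv, v', hv', e1, e2, e3, e4, e5⟩ := h3 h h.2 s hs ⟨a, a.2, ha, (hsS' a).2 hSa⟩
        ⟨b, b.2, hb, fun e => hSb ((hsS' b).1 e)⟩
      exact ⟨⟨v, hv⟩, ⟨v', hv'⟩, e1, e2, (hsS' ⟨v, hv⟩).1 e3, fun e => e4 ((hsS' ⟨v', hv'⟩).2 e),
        (x.adjAt_iff t ⟨v, hv⟩ ⟨v', hv'⟩).1 e5⟩
    · obtain ⟨v, hv, v', hv', e1, e2, e3⟩ := h4 h h.2 h' h'.2 ((x.hAdj_iff h h').2 a)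
      exact ⟨⟨v, hv⟩, ⟨v', hv'⟩, e1, e2, (x.adjAt_iff t ⟨v, hv⟩ ⟨v', hv'⟩).1 e3⟩
  · rintro ⟨R, hR⟩
    choose φ hφ using hR.nonempty
    have hmn : x.m ≤ x.n := by
      simpa using Fintype.card_le_of_injective φ fun h h' e =>
        hR.disjoint h h' (φ h) (hφ h) (e ▸ hφ h')
    obtain ⟨c, hc, hcR⟩ := exists_mask_rel hmn R
    refine ⟨hmn, c, hc, fun h hh => ⟨φ ⟨h, hh⟩, (φ _).2, (hcR ⟨h, hh⟩ _).2 (hφ _)⟩,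
      fun h hh h' hh' v hv e e' => ?_, fun h hh S hS h1 h2 => ?_, fun h hh h' hh' a => ?_⟩
    · exact congrArg Fin.val (hR.disjoint ⟨h, hh⟩ ⟨h', hh'⟩ ⟨v, hv⟩ ((hcR _ _).1 e) ((hcR _ _).1 e'))
    · obtain ⟨a, ha, e1, e2⟩ := h1
      obtain ⟨b, hb, e3, e4⟩ := h2
      obtain ⟨v, v', f1, f2, f3, f4, f5⟩ := hR.connected ⟨h, hh⟩ (fun v => S.testBit v = true)
        ⟨⟨a, ha⟩, (hcR _ _).1 e1, e2⟩ ⟨⟨b, hb⟩, (hcR _ _).1 e3, e4⟩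
      exact ⟨v, v.2, v', v'.2, (hcR ⟨h, hh⟩ v).2 f1, (hcR ⟨h, hh⟩ v').2 f2, f3, f4,
        (x.adjAt_iff t v v').2 f5⟩
    · obtain ⟨v, v', f1, f2, f3⟩ := hR.adj ⟨h, hh⟩ ⟨h', hh'⟩ ((x.hAdj_iff ⟨h, hh⟩ ⟨h', hh'⟩).1 a)
      exact ⟨v, v.2, v', v'.2, (hcR ⟨h, hh⟩ v).2 f1, (hcR ⟨h', hh'⟩ v').2 f2, (x.adjAt_iff t v v').2 f3⟩

/-- An upper bound for the number of bits of the numbers that occur in the computation. -/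
noncomputable def bits : ℕ := (x.encode.length + 1) * (x.itemCount + 1)

theorem two_pow_lt_bits {e : ℕ} (he : e ≤ x.itemCount) : 2 ^ (x.encode.length * e) < 2 ^ x.bits := by
  refine Nat.pow_lt_pow_right (by norm_num) ?_
  rw [bits]
  nlinarith [Nat.mul_le_mul_left x.encode.length he]

theorem itemLen_le (e : ℕ) : x.itemLen e ≤ x.encode.length := x.wordLen_le _

theorem search_lt {c r e n : ℕ} (he : e < x.itemCount) (hr : r ≤ 2 ^ (x.encode.length * e)) (q : ℕ)
    (hn : n ≤ x.itemLen e) :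
    Periodic.search (Periodic.modulus (x.Selected c) x.itemLen e) (x.itemLen e) q r n < 2 ^ x.bits :=
  (Periodic.search_residue_le _ x.itemLen_le hr q hn).trans_lt (x.two_pow_lt_bits he)

/-- Residue and modulus contribute `N K` bits and the factor `j + 1 ≤ 2 ^ K` another `K`, where `N`
is the input length and `K` is `itemCount`. -/
theorem timeAt_lt {c j : ℕ} (hj : j < 2 ^ x.itemCount) : x.timeAt c j < 2 ^ x.bits := by
  have h1 := Periodic.residue_le (x.Selected c) (p := x.itemPos) x.itemLen_le x.itemCount
  have h2 := Periodic.modulus_le (x.Selected c) x.itemLen_le x.itemCount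
  calc x.timeAt c j ≤ 2 ^ (x.encode.length * x.itemCount) + j * 2 ^ (x.encode.length * x.itemCount) :=
        Nat.add_le_add h1 (Nat.mul_le_mul_left j h2)
    _ = 2 ^ (x.encode.length * x.itemCount) * (j + 1) := by ring
    _ ≤ 2 ^ (x.encode.length * x.itemCount) * 2 ^ x.itemCount := Nat.mul_le_mul_left _ hj
    _ < 2 ^ x.bits := by
      rw [← pow_add]
      refine Nat.pow_lt_pow_right (by norm_num) ?_
      rw [bits]
      nlinarith

end EPGInstance

/-! ### Computing with instances -/

namespace RAM

open Ctx

section Search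

variable {I : Type} {enc : I → List (Fin 3)} {par : I → ℕ} {α : Type} {ι : α → I}
  {Γ : Ctx enc par ι}

theorem Comp.nthPos {A : α → ℕ → Prop} [∀ a, DecidablePred (A a)] {n k : α → ℕ} (hn : Comp Γ n)
    (hB : Γ.Bdd n) (hk : Comp Γ k)
    (hA : Under Γ n fun Γ' => Under Γ' (fun x => x.2 + 1) fun Γ'' => CompP Γ'' fun y => A y.1.1 y.2) :
    Comp Γ fun a => nthPos (A a) (n a) (k a) :=
  .count hn hB fun Γ' E hi hx => .le (.count (hx.add (.const 1))
    ((hB.lift E).mono fun x h => hi x h) (hA Γ' E hi hx)) (hk.lift E)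

theorem Comp.search {M L p x n b : α → ℕ} (hM : Comp Γ M) (hL : Comp Γ L) (hp : Comp Γ p)
    (hx : Comp Γ x) (hn : Comp Γ n) (hnB : Γ.Bdd n) (hb : Comp Γ b) (hB : Γ.Bdd b)
    (hlt : ∀ a, Γ.dom a → ∀ i ≤ n a, Periodic.search (M a) (L a) (p a) (x a) i < 2 ^ b a) :
    Comp Γ fun a => Periodic.search (M a) (L a) (p a) (x a) (n a) := by
  refine .fold (acc := fun a i => Periodic.search (M a) (L a) (p a) (x a) i) hn hnB hx
    fun Γ' E hi hy hacc => ?_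
  exact .ite (.eq (.mod hacc (hL.lift E) (hb.lift E) (hB.lift E)
    fun y h => hlt y.1 (E.dom h) y.2 (hi y h).le) (hp.lift E)) hacc (hacc.add (hM.lift E))

end Search

variable {α : Type} {ι : α → EPGInstance} {Γ : Ctx EPGInstance.encode EPGInstance.param ι}
  {b c e h h' i j k q t u v : α → ℕ}

theorem Comp.letter (hi : Comp Γ i) : Comp Γ fun a => (ι a).letter (i a) := hi.read

theorem Comp.sep (hk : Comp Γ k) : Comp Γ fun a => (ι a).sep (k a) :=
  .nthPos .length .length hk fun _ _ _ _ _ _ _ hy => .eq hy.read (.const 2)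

theorem Comp.n : Comp Γ fun a => (ι a).n :=
  (Comp.sep (.const 0)).congr fun a _ => (ι a).sep_zero

theorem ParBdd.n : Γ.ParBdd fun a => (ι a).n := ParBdd.param.mono fun a _ => (ι a).n_le_param

theorem Comp.wordLen (hq : Comp Γ q) : Comp Γ fun a => (ι a).wordLen (q a) :=
  (Comp.sep (hq.add (.const 1))).sub ((Comp.sep hq).add (.const 1))

theorem Bdd.wordLen : Γ.Bdd fun a => (ι a).wordLen (q a) :=
  Bdd.length.mono fun a _ => (ι a).wordLen_le _

theorem Comp.wordLetter (hq : Comp Γ q) (hi : Comp Γ i) : Comp Γ fun a => (ι a).wordLetter (q a) (i a) :=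
  .letter (((Comp.sep hq).add (.const 1)).add hi)

theorem Comp.nn : Comp Γ fun a => (ι a).n * (ι a).n := .mul .n .n ParBdd.n.bdd

theorem ParBdd.nn : Γ.ParBdd fun a => (ι a).n * (ι a).n := ParBdd.n.mul ParBdd.n

theorem Comp.m : Comp Γ fun a => (ι a).m :=
  (Comp.wordLen .nn).congr fun a _ => (ι a).wordLen_last

/-- The order of `H` is bounded by the input length but not by the parameter, so loops over its
vertices are charged to the polynomial factor. -/
theorem Bdd.m : Γ.Bdd fun a => (ι a).m := Bdd.length.mono fun a _ => (ι a).m_le_length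

theorem CompP.hAdj (hh : Comp Γ h) (hh' : Comp Γ h') : CompP Γ fun a => (ι a).hAdj (h a) (h' a) :=
  .eq (.letter (((Comp.sep (Comp.nn.add (.const 1))).add (.const 1)).add ((hh.mul .m Bdd.m).add hh')))
    (.const 1)

theorem Comp.index (hu : Comp Γ u) (hv : Comp Γ v) : Comp Γ fun a => u a * (ι a).n + v a :=
  (hu.mul .n ParBdd.n.bdd).add hv

theorem CompP.adjAt (ht : Comp Γ t) (hb : Comp Γ b) (hB : Γ.Bdd b)
    (hlt : ∀ a, Γ.dom a → t a < 2 ^ b a) (hu : Comp Γ u) (hv : Comp Γ v) :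
    CompP Γ fun a => (ι a).adjAt (t a) (u a) (v a) :=
  have hL := Comp.wordLen (Comp.index hu hv)
  (CompP.eq hL (.const 0)).not.and
    (.eq (.wordLetter (Comp.index hu hv) (.mod ht hL hb hB hlt)) (.const 1))

theorem Comp.letterCount (hb : Comp Γ b) (hq : Comp Γ q) :
    Comp Γ fun a => (ι a).letterCount (b a) (q a) :=
  .count (.wordLen hq) Bdd.wordLen fun _ E _ hx => .eq (.wordLetter (hq.lift E) hx) (hb.lift E)

theorem Comp.maxCount (hb : Comp Γ b) : Comp Γ fun a => (ι a).maxCount (b a) :=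
  .sup .nn ParBdd.nn.bdd fun _ E _ hx => .letterCount (hb.lift E) hx

theorem Comp.minorCount : Comp Γ fun a => (ι a).minorCount :=
  .min (.maxCount (.const 0)) (.maxCount (.const 1))

theorem ParBdd.minorCount : Γ.ParBdd fun a => (ι a).minorCount :=
  ParBdd.param.mono fun a _ => (ι a).minorCount_le_param

theorem Comp.minorLetter : Comp Γ fun a => (ι a).minorLetter :=
  .ite (.le (.maxCount (.const 0)) (.maxCount (.const 1))) (.const 0) (.const 1)

theorem Comp.itemCount : Comp Γ fun a => (ι a).itemCount :=
  Comp.nn.mul (Comp.minorCount.add (.const 1)) (ParBdd.minorCount.add (ParBdd.const 1)).bdd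

theorem ParBdd.itemCount : Γ.ParBdd fun a => (ι a).itemCount :=
  ParBdd.nn.mul (ParBdd.minorCount.add (ParBdd.const 1))

theorem Comp.bits : Comp Γ fun a => (ι a).bits :=
  (Comp.length.add (.const 1)).mul (Comp.itemCount.add (.const 1))
    (ParBdd.itemCount.add (ParBdd.const 1)).bdd

theorem Bdd.bits : Γ.Bdd fun a => (ι a).bits :=
  (Bdd.length.add (Bdd.const 1)).mul (ParBdd.itemCount.add (ParBdd.const 1)).bdd

/-! ### Computing the candidate times. -/

theorem Comp.itemWord (he : Comp Γ e) (heB : Γ.Bdd e) :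
    Comp Γ fun a => e a / ((ι a).minorCount + 1) :=
  .div he heB (Comp.minorCount.add (.const 1)) fun _ _ => Nat.succ_pos _

theorem Comp.itemLen (he : Comp Γ e) (heB : Γ.Bdd e) : Comp Γ fun a => (ι a).itemLen (e a) :=
  .wordLen (.itemWord he heB)

theorem Bdd.itemLen : Γ.Bdd fun a => (ι a).itemLen (e a) := Bdd.wordLen

theorem Comp.itemPos (he : Comp Γ e) (heB : Γ.Bdd e) : Comp Γ fun a => (ι a).itemPos (e a) :=
  .nthPos (.wordLen (.itemWord he heB)) Bdd.wordLen
    (.mod_of_bdd he heB (Comp.minorCount.add (.const 1)))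
    fun _ E _ _ _ E' _ hy => .eq (.wordLetter (((Comp.itemWord he heB).lift E).lift E') hy) .minorLetter

theorem CompP.selected (hc : Comp Γ c) (he : Comp Γ e) (heB : Γ.Bdd e) :
    CompP Γ fun a => (ι a).Selected (c a) (e a) :=
  (CompP.testBit hc he heB).and (.lt (.itemPos he heB) (.itemLen he heB))

theorem Comp.modulus (hc : Comp Γ c) (hk : Comp Γ k) (hkB : Γ.Bdd k)
    (hle : ∀ a, Γ.dom a → k a ≤ (ι a).itemCount) :
    Comp Γ fun a => Periodic.modulus ((ι a).Selected (c a)) (ι a).itemLen (k a) := by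
  refine .fold (acc := fun a i => Periodic.modulus ((ι a).Selected (c a)) (ι a).itemLen i) hk hkB
    (.const 1) fun Γ' E hi hx hacc => ?_
  have hxB : Γ'.Bdd Prod.snd := (hkB.lift E).mono fun x h => (hi x h).le
  have hL := Comp.itemLen hx hxB
  refine .ite (.selected (hc.lift E) hx hxB)
    (.search hacc hL (.const 0) hacc hL Bdd.itemLen .bits Bdd.bits fun x hxd i hin => ?_) hacc
  exact (ι x.1).search_lt ((hi x hxd).trans_le (hle _ (E.dom hxd)))
    (Periodic.modulus_le _ (ι x.1).itemLen_le _) _ hin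

theorem Comp.residue (hc : Comp Γ c) (hk : Comp Γ k) (hkB : Γ.Bdd k)
    (hle : ∀ a, Γ.dom a → k a ≤ (ι a).itemCount) :
    Comp Γ fun a => Periodic.residue ((ι a).Selected (c a)) (ι a).itemLen (ι a).itemPos (k a) := by
  refine .fold (acc := fun a i =>
    Periodic.residue ((ι a).Selected (c a)) (ι a).itemLen (ι a).itemPos i) hk hkB
    (.const 0) fun Γ' E hi hx hacc => ?_
  have hxB : Γ'.Bdd Prod.snd := (hkB.lift E).mono fun x h => (hi x h).le
  have hlt : ∀ x, Γ'.dom x → x.2 < (ι x.1).itemCount := fun x h =>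
    (hi x h).trans_le (hle _ (E.dom h))
  have hL := Comp.itemLen hx hxB
  refine .ite (.selected (hc.lift E) hx hxB)
    -- The recursion carries a single number, so the current modulus is recomputed in every round.
    (.search (.modulus (hc.lift E) hx hxB fun x h => (hlt x h).le) hL (.itemPos hx hxB) hacc hL
      Bdd.itemLen .bits Bdd.bits fun x hxd i hin => ?_) hacc
  exact (ι x.1).search_lt (hlt x hxd) (Periodic.residue_le _ (ι x.1).itemLen_le _) _ hin

/-- In the product of the modulus with `j`, the factor `j` counts the additions, as the modulus is
too large for that. -/
theorem Comp.timeAt (hc : Comp Γ c) (hj : Comp Γ j) (hjB : Γ.Bdd j) :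
    Comp Γ fun a => (ι a).timeAt (c a) (j a) :=
  have hB := ParBdd.itemCount.bdd
  ((Comp.residue hc .itemCount hB fun _ _ => le_rfl).add
    ((Comp.modulus hc .itemCount hB fun _ _ => le_rfl).mul hj hjB)).congr fun a _ => by
      rw [EPGInstance.timeAt, mul_comm (j a)]

/-! ### Deciding the tests at a given time. -/

theorem CompP.entry (hc : Comp Γ c) (hu : Comp Γ u) (huB : Γ.Bdd u) (hv : Comp Γ v) (hvB : Γ.Bdd v) :
    CompP Γ fun a => (c a).testBit (u a * (ι a).n + v a) = true :=
  .testBit hc (Comp.index hu hv) ((huB.mul ParBdd.n.bdd).add hvB)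

theorem CompP.coversRows (hc : Comp Γ c) :
    CompP Γ fun a => ∀ h < (ι a).m, ∃ v < (ι a).n, (c a).testBit (h * (ι a).n + v) = true := by
  refine .all .m Bdd.m fun Γ₁ E₁ i₁ h₁ => .ex .n ParBdd.n.bdd fun Γ₂ E₂ i₂ h₂ => ?_
  exact .entry ((hc.lift E₁).lift E₂) (h₁.lift E₂) (Bdd.m.mono fun x h => (i₁ _ (E₂.dom h)).le) h₂
    (ParBdd.n.bdd.mono fun x h => (i₂ x h).le)

theorem CompP.disjointRows (hc : Comp Γ c) :
    CompP Γ fun a => ∀ h < (ι a).m, ∀ h' < (ι a).m, ∀ v < (ι a).n,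
      (c a).testBit (h * (ι a).n + v) = true → (c a).testBit (h' * (ι a).n + v) = true → h = h' := by
  refine .all .m Bdd.m fun Γ₁ E₁ i₁ h₁ => .all .m Bdd.m fun Γ₂ E₂ i₂ h₂ =>
    .all .n ParBdd.n.bdd fun Γ₃ E₃ i₃ h₃ => ?_
  have hc := ((hc.lift E₁).lift E₂).lift E₃
  have h₁ := (h₁.lift E₂).lift E₃
  have h₂ := h₂.lift E₃
  have b₃ : Γ₃.Bdd Prod.snd := ParBdd.n.bdd.mono fun x h => (i₃ x h).le
  exact (CompP.entry hc h₁ (Bdd.m.mono fun x h => (i₁ _ (E₂.dom (E₃.dom h))).le) h₃ b₃).imp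
    ((CompP.entry hc h₂ (Bdd.m.mono fun x h => (i₂ _ (E₃.dom h)).le) h₃ b₃).imp (.eq h₁ h₂))

theorem CompP.inducedAt (ht : Comp Γ t) (hlt : ∀ a, Γ.dom a → t a < 2 ^ (ι a).bits) :
    CompP Γ fun a => (ι a).InducedAt (t a) := by
  refine (CompP.le .m .n).and (.ex (.two_pow .nn ParBdd.nn.bdd) ParBdd.nn.two_pow.bdd
    fun Γ₀ E₀ _ hc => (CompP.coversRows hc).and ((CompP.disjointRows hc).and ?_))
  refine .all .m Bdd.m fun Γ₁ E₁ i₁ h₁ => .all .m Bdd.m fun Γ₂ E₂ i₂ h₂ =>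
    .all .n ParBdd.n.bdd fun Γ₃ E₃ i₃ h₃ => .all .n ParBdd.n.bdd fun Γ₄ E₄ i₄ h₄ => ?_
  have hc := (((hc.lift E₁).lift E₂).lift E₃).lift E₄
  have ht := ((((ht.lift E₀).lift E₁).lift E₂).lift E₃).lift E₄
  have h₁ := ((h₁.lift E₂).lift E₃).lift E₄
  have h₂ := (h₂.lift E₃).lift E₄
  have h₃ := h₃.lift E₄
  exact (CompP.entry hc h₁ (Bdd.m.mono fun x h => (i₁ _ (E₂.dom (E₃.dom (E₄.dom h)))).le) h₃
    (ParBdd.n.bdd.mono fun x h => (i₃ _ (E₄.dom h)).le)).imp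
    ((CompP.entry hc h₂ (Bdd.m.mono fun x h => (i₂ _ (E₃.dom (E₄.dom h))).le) h₄
      (ParBdd.n.bdd.mono fun x h => (i₄ x h).le)).imp
      ((CompP.hAdj h₁ h₂).iff (.adjAt ht .bits Bdd.bits
        (fun x h => hlt _ (E₀.dom (E₁.dom (E₂.dom (E₃.dom (E₄.dom h)))))) h₃ h₄)))

/-- Formulating connectedness by cuts leaves only bounded quantifiers, those over cuts ranging over
the `2 ^ n` bit masks. -/
theorem CompP.connectedRows (hc : Comp Γ c) (ht : Comp Γ t)
    (hlt : ∀ a, Γ.dom a → t a < 2 ^ (ι a).bits) :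
    CompP Γ fun a => ∀ h < (ι a).m, ∀ S < 2 ^ (ι a).n,
      (∃ v < (ι a).n, (c a).testBit (h * (ι a).n + v) = true ∧ S.testBit v = true) →
      (∃ v < (ι a).n, (c a).testBit (h * (ι a).n + v) = true ∧ ¬ S.testBit v = true) →
      ∃ v < (ι a).n, ∃ v' < (ι a).n, (c a).testBit (h * (ι a).n + v) = true ∧
        (c a).testBit (h * (ι a).n + v') = true ∧ S.testBit v = true ∧ ¬ S.testBit v' = true ∧
          (ι a).adjAt (t a) v v' := by
  refine .all .m Bdd.m fun Γ₁ E₁ i₁ h₁ => .all (.two_pow .n ParBdd.n.bdd) ParBdd.n.two_pow.bdd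
    fun Γ₂ E₂ _ hS => .imp ?_ (.imp ?_ ?_)
  · refine .ex .n ParBdd.n.bdd fun Γ₃ E₃ i₃ h₃ => ?_
    have b₃ : Γ₃.Bdd Prod.snd := ParBdd.n.bdd.mono fun x h => (i₃ x h).le
    exact (CompP.entry (((hc.lift E₁).lift E₂).lift E₃) ((h₁.lift E₂).lift E₃)
      (Bdd.m.mono fun x h => (i₁ _ (E₂.dom (E₃.dom h))).le) h₃ b₃).and (.testBit (hS.lift E₃) h₃ b₃)
  · refine .ex .n ParBdd.n.bdd fun Γ₃ E₃ i₃ h₃ => ?_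
    have b₃ : Γ₃.Bdd Prod.snd := ParBdd.n.bdd.mono fun x h => (i₃ x h).le
    exact (CompP.entry (((hc.lift E₁).lift E₂).lift E₃) ((h₁.lift E₂).lift E₃)
      (Bdd.m.mono fun x h => (i₁ _ (E₂.dom (E₃.dom h))).le) h₃ b₃).and
        (CompP.testBit (hS.lift E₃) h₃ b₃).not
  · refine .ex .n ParBdd.n.bdd fun Γ₃ E₃ i₃ h₃ => .ex .n ParBdd.n.bdd fun Γ₄ E₄ i₄ h₄ => ?_
    have hc := (((hc.lift E₁).lift E₂).lift E₃).lift E₄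
    have ht := (((ht.lift E₁).lift E₂).lift E₃).lift E₄
    have h₁ := ((h₁.lift E₂).lift E₃).lift E₄
    have hS := (hS.lift E₃).lift E₄
    have h₃ := h₃.lift E₄
    have b₁ : Γ₄.Bdd fun x => x.1.1.1.2 :=
      Bdd.m.mono fun x h => (i₁ _ (E₂.dom (E₃.dom (E₄.dom h)))).le
    have b₃ : Γ₄.Bdd fun x => x.1.2 := ParBdd.n.bdd.mono fun x h => (i₃ _ (E₄.dom h)).le
    have b₄ : Γ₄.Bdd Prod.snd := ParBdd.n.bdd.mono fun x h => (i₄ x h).le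
    exact (CompP.entry hc h₁ b₁ h₃ b₃).and ((CompP.entry hc h₁ b₁ h₄ b₄).and
      ((CompP.testBit hS h₃ b₃).and ((CompP.testBit hS h₄ b₄).not.and
        (.adjAt ht .bits Bdd.bits (fun x h => hlt _ (E₁.dom (E₂.dom (E₃.dom (E₄.dom h))))) h₃ h₄))))

theorem CompP.adjacentRows (hc : Comp Γ c) (ht : Comp Γ t)
    (hlt : ∀ a, Γ.dom a → t a < 2 ^ (ι a).bits) :
    CompP Γ fun a => ∀ h < (ι a).m, ∀ h' < (ι a).m, (ι a).hAdj h h' → ∃ v < (ι a).n,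
      ∃ v' < (ι a).n, (c a).testBit (h * (ι a).n + v) = true ∧
        (c a).testBit (h' * (ι a).n + v') = true ∧ (ι a).adjAt (t a) v v' := by
  refine .all .m Bdd.m fun Γ₁ E₁ i₁ h₁ => .all .m Bdd.m fun Γ₂ E₂ i₂ h₂ =>
    .imp (.hAdj (h₁.lift E₂) h₂) (.ex .n ParBdd.n.bdd fun Γ₃ E₃ i₃ h₃ =>
      .ex .n ParBdd.n.bdd fun Γ₄ E₄ i₄ h₄ => ?_)
  have hc := (((hc.lift E₁).lift E₂).lift E₃).lift E₄
  have ht := (((ht.lift E₁).lift E₂).lift E₃).lift E₄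
  have h₁ := ((h₁.lift E₂).lift E₃).lift E₄
  have h₂ := (h₂.lift E₃).lift E₄
  have h₃ := h₃.lift E₄
  exact (CompP.entry hc h₁ (Bdd.m.mono fun x h => (i₁ _ (E₂.dom (E₃.dom (E₄.dom h)))).le) h₃
    (ParBdd.n.bdd.mono fun x h => (i₃ _ (E₄.dom h)).le)).and
    ((CompP.entry hc h₂ (Bdd.m.mono fun x h => (i₂ _ (E₃.dom (E₄.dom h))).le) h₄
      (ParBdd.n.bdd.mono fun x h => (i₄ x h).le)).and
      (.adjAt ht .bits Bdd.bits (fun x h => hlt _ (E₁.dom (E₂.dom (E₃.dom (E₄.dom h))))) h₃ h₄))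

theorem CompP.minorAt (ht : Comp Γ t) (hlt : ∀ a, Γ.dom a → t a < 2 ^ (ι a).bits) :
    CompP Γ fun a => (ι a).MinorAt (t a) :=
  (CompP.le .m .n).and (.ex (.two_pow .nn ParBdd.nn.bdd) ParBdd.nn.two_pow.bdd
    fun _ E _ hc => (CompP.coversRows hc).and ((CompP.disjointRows hc).and
      ((CompP.connectedRows hc (ht.lift E) fun _ h => hlt _ (E.dom h)).and
        (CompP.adjacentRows hc (ht.lift E) fun _ h => hlt _ (E.dom h)))))

/-- Searching all candidate times for a snapshot with a decidable property. -/
theorem CompP.exists_timeAt {Q : EPGInstance → ℕ → Prop}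
    (hQ : ∀ {β : Type} {κ : β → EPGInstance} {Δ : Ctx EPGInstance.encode EPGInstance.param κ}
      {t : β → ℕ}, Comp Δ t → (∀ a, Δ.dom a → t a < 2 ^ (κ a).bits) → CompP Δ fun a => Q (κ a) (t a)) :
    CompP Γ fun a => ∃ c < 2 ^ (ι a).itemCount, ∃ j < 2 ^ (ι a).itemCount,
      Q (ι a) ((ι a).timeAt c j) := by
  have hK : ∀ {β : Type} {κ : β → EPGInstance} {Δ : Ctx EPGInstance.encode EPGInstance.param κ},
      Comp Δ fun a => 2 ^ (κ a).itemCount := .two_pow .itemCount ParBdd.itemCount.bdd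
  refine .ex hK ParBdd.itemCount.two_pow.bdd fun Γ₁ E₁ i₁ h₁ =>
    .ex hK ParBdd.itemCount.two_pow.bdd fun Γ₂ E₂ i₂ h₂ => ?_
  exact hQ (.timeAt (h₁.lift E₂) h₂ (ParBdd.itemCount.two_pow.bdd.mono fun x h => (i₂ x h).le))
    fun x h => (ι x.1.1).timeAt_lt (i₂ x h)

end RAM

/-- A problem that asks for a snapshot with a property that can be tested at a given time is
fixed-parameter tractable. -/
theorem isFPT_exists_snapshot {Y : EPGInstance → Prop} (Q : EPGInstance → ℕ → Prop)
    (hQ : ∀ {β : Type} {κ : β → EPGInstance} {Δ : Ctx EPGInstance.encode EPGInstance.param κ}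
      {t : β → ℕ}, Comp Δ t → (∀ a, Δ.dom a → t a < 2 ^ (κ a).bits) → CompP Δ fun a => Q (κ a) (t a))
    (hsnap : ∀ x t t', x.𝒢.snapshot t = x.𝒢.snapshot t' → Q x t → Q x t')
    (hY : ∀ x, Y x ↔ ∃ t, Q x t) :
    ParamProblem.IsFPT ⟨EPGInstance, EPGInstance.encode, EPGInstance.param, Y⟩ := by
  refine ParamProblem.isFPT_of_compP _ ((CompP.exists_timeAt hQ).congr fun x _ => ?_)
  refine Iff.trans ⟨fun ⟨c, _, j, _, h⟩ => ⟨_, h⟩, fun ⟨t, h⟩ => ?_⟩ (hY x).symm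
  obtain ⟨c, hc, j, hj, he⟩ := x.exists_snapshot_timeAt t
  exact ⟨c, hc, j, hj, hsnap x _ _ he.symm h⟩

theorem mainTheorem7 :
    EPGSubgraph.IsFPT ∧ EPGSubgraphFree.IsFPT ∧ EPGMinor.IsFPT ∧ EPGMinorFree.IsFPT := by
  have hI : ∀ x : EPGInstance, ∀ t t', x.𝒢.snapshot t = x.𝒢.snapshot t' →
      (x.InducedAt t ↔ x.InducedAt t') := fun x t t' h => by
    rw [x.inducedAt_iff, x.inducedAt_iff, h]
  have hM : ∀ x : EPGInstance, ∀ t t', x.𝒢.snapshot t = x.𝒢.snapshot t' →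
      (x.MinorAt t ↔ x.MinorAt t') := fun x t t' h => by
    rw [x.minorAt_iff, x.minorAt_iff, h]
  refine ⟨?_, ?_, ?_, ?_⟩
  · exact isFPT_exists_snapshot EPGInstance.InducedAt CompP.inducedAt
      (fun x t t' h => (hI x t t' h).1) fun x => exists_congr fun t => (x.inducedAt_iff t).symm
  · exact isFPT_exists_snapshot (fun x t => ¬ x.InducedAt t) (fun ht hlt => (CompP.inducedAt ht hlt).not)
      (fun x t t' h => (not_congr (hI x t t' h)).1)
      fun x => exists_congr fun t => not_congr (x.inducedAt_iff t).symm
  · exact isFPT_exists_snapshot EPGInstance.MinorAt CompP.minorAt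
      (fun x t t' h => (hM x t t' h).1) fun x => exists_congr fun t => (x.minorAt_iff t).symm
  · exact isFPT_exists_snapshot (fun x t => ¬ x.MinorAt t) (fun ht hlt => (CompP.minorAt ht hlt).not)
      (fun x t t' h => (not_congr (hM x t t' h)).1)
      fun x => exists_congr fun t => not_congr (x.minorAt_iff t).symm
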